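/- Let $G$ be a simple graph (of any cardinality, not necessarily connected). A ray of $G$ is a one-way infinite path $v_0v_1v_2\dots$ in $G$, and a double ray is a two-way infinite path. Two rays are edge-equivalent if, for every finite set $F$ of edges of $G$, they have tails in the same connected component of $G\setminus F$; the classes $[r]_E$ of rays under this equivalence relation are the edge-ends of $G$, and $\Omega_E(G)$ is the set of all edge-ends. For an edge-end $\omega$ and a finite edge set $F$, let $C_E(F,\omega)$ be the vertex set of the component of $G\setminus F$ in which the rays of $\omega$ have tails. A vertex $v$ edge-dominates $\omega$ if $v\in C_E(F,\omega)$ for every finite edge set $F$. For a vertex $v$ and an edge-end $\omega$, a $v$–$\omega$ path is either a ray starting at $v$ whose edge-end is $\omega$, or a finite path from $v$ to a vertex that edge-dominates $\omega$. For edge-ends $\omega_1,\omega_2$, an $\omega_1$–$\omega_2$ path is either a $v$–$\omega_i$ path for some $i\in\{1,2\}$ and some vertex $v$ that edge-dominates $\omega_{3-i}$, or a double ray in which one half-ray has edge-end $\omega_1$ and the other has edge-end $\omega_2$. For $A,B\subseteq\Omega_E(G)$, an $A$–$B$ path is an $a$–$b$ path for some $a\in A$ and $b\in B$. Let $A,B\subseteq\Omega_E(G)$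 be disjoint sets of edge-ends. Suppose that there is a finite edge set $F\subseteq E(G)$ such that $G\setminus F$ contains no $A$–$B$ path (that is, every $A$–$B$ path of $G$ uses an edge of $F$), and let $F$ have minimum size with this property. Then there is a family $\mathcal P$ of exactly $|F|$ pairwise edge-disjoint $A$–$B$ paths in $G$. -/

import Mathlib

namespace EdgeEnds

universe u

variable {V : Type u} {G : SimpleGraph V}

/-- A ray `v₀ v₁ v₂ …` of the graph `G`: a one-way infinite path. -/
structure Ray (G : SimpleGraph V) where
  vert : ℕ → V
  injective : Function.Injective vert
  adj : ∀ n, G.Adj (vert n) (vert (n + 1))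

/-- The subgraph formed by the vertices and edges of a ray. -/
def Ray.toSubgraph (r : Ray G) : G.Subgraph where
  verts := Set.range r.vert
  Adj x y := ∃ n, s(x, y) = s(r.vert n, r.vert (n + 1))
  adj_sub := by
    rintro x y ⟨n, h⟩
    have := r.adj n
    rwa [← SimpleGraph.mem_edgeSet, ← h, SimpleGraph.mem_edgeSet] at this
  edge_vert := by
    rintro x y ⟨n, h⟩
    rcases Sym2.eq_iff.mp h with ⟨rfl, -⟩ | ⟨rfl, -⟩
    · exact ⟨n, rfl⟩
    · exact ⟨n + 1, rfl⟩
  symm := ⟨fun x y ⟨n, h⟩ => ⟨n, by rw [Sym2.eq_swap]; exact h⟩⟩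

/-- The ray `r` has a tail contained in the connected component `C` of `G ∖ F`. -/
def Ray.HasTailIn (r : Ray G) (F : Set (Sym2 V))
    (C : (G.deleteEdges F).ConnectedComponent) : Prop :=
  ∃ N, ∀ n, N ≤ n → (G.deleteEdges F).Adj (r.vert n) (r.vert (n + 1)) ∧
    (G.deleteEdges F).connectedComponentMk (r.vert n) = C

/-- A ray has a tail in some component of `G ∖ F` when `F` is finite. -/
theorem Ray.exists_hasTailIn (r : Ray G) {F : Set (Sym2 V)} (hF : F.Finite) :
    ∃ C, r.HasTailIn F C := by
  have hinj : Function.Injective (fun n => s(r.vert n, r.vert (n + 1))) := by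
    intro m n h
    rcases Sym2.eq_iff.mp h with ⟨h1, -⟩ | ⟨h1, h2⟩
    · exact r.injective h1
    · have h1 := r.injective h1
      have h2 := r.injective h2
      omega
  have hfin : ((fun n => s(r.vert n, r.vert (n + 1))) ⁻¹' F).Finite :=
    hF.preimage hinj.injOn
  obtain ⟨N, hN⟩ := hfin.bddAbove
  have hadj : ∀ n, N + 1 ≤ n → (G.deleteEdges F).Adj (r.vert n) (r.vert (n + 1)) := by
    intro n hn
    rw [SimpleGraph.deleteEdges_adj]
    refine ⟨r.adj n, fun h => ?_⟩
    have := hN (show n ∈ _ from h)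
    omega
  refine ⟨(G.deleteEdges F).connectedComponentMk (r.vert (N + 1)), N + 1, fun n hn =>
    ⟨hadj n hn, ?_⟩⟩
  induction n, hn using Nat.le_induction with
  | base => rfl
  | succ n hn ih =>
    rw [← ih]
    exact (SimpleGraph.ConnectedComponent.eq.mpr (hadj n hn).reachable).symm

/-- The component of `G ∖ F` in which a ray has a tail is unique. -/
theorem Ray.HasTailIn.unique {r : Ray G} {F : Set (Sym2 V)}
    {C D : (G.deleteEdges F).ConnectedComponent} (hC : r.HasTailIn F C)
    (hD : r.HasTailIn F D) : C = D := by
  obtain ⟨M, hM⟩ := hC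
  obtain ⟨N, hN⟩ := hD
  rw [← (hM (max M N) (le_max_left _ _)).2, ← (hN (max M N) (le_max_right _ _)).2]

/-- Edge-equivalence of rays: for every finite set `F` of edges, `r` and `s` have tails in the
same connected component of `G ∖ F`. -/
def EdgeEquiv (r s : Ray G) : Prop :=
  ∀ F : Set (Sym2 V), F.Finite → F ⊆ G.edgeSet → ∃ C, r.HasTailIn F C ∧ s.HasTailIn F C

instance edgeSetoid (G : SimpleGraph V) : Setoid (Ray G) where
  r := EdgeEquiv
  iseqv :=
    { refl := fun r F hF _ => by
        obtain ⟨C, hC⟩ := r.exists_hasTailIn hF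
        exact ⟨C, hC, hC⟩
      symm := fun h F hF hE => by
        obtain ⟨C, h1, h2⟩ := h F hF hE
        exact ⟨C, h2, h1⟩
      trans := fun h h' F hF hE => by
        obtain ⟨C, h1, h2⟩ := h F hF hE
        obtain ⟨D, h3, h4⟩ := h' F hF hE
        exact ⟨C, h1, by rwa [h2.unique h3]⟩ }

/-- The edge-end space `Ω_E(G)`. -/
def EdgeEnd (G : SimpleGraph V) : Type u := Quotient (edgeSetoid G)

/-- The edge-end `[r]_E` of a ray. -/
def Ray.edgeEnd (r : Ray G) : EdgeEnd G := Quotient.mk (edgeSetoid G) r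

/-- `C_E(F, ω)`: the vertices of the connected component of `G ∖ F` in which the
representatives of `ω` have tails. -/
def EdgeEnd.component (F : Set (Sym2 V)) (ω : EdgeEnd G) : Set V :=
  {v | ∃ r : Ray G, r.edgeEnd = ω ∧ r.HasTailIn F ((G.deleteEdges F).connectedComponentMk v)}

/-- For a finite edge set, `C_E(F, [r]_E)` does not depend on the representative. -/
theorem EdgeEnd.mem_component_edgeEnd_iff {F : Set (Sym2 V)} (hF : F.Finite)
    (hE : F ⊆ G.edgeSet) (r : Ray G) (v : V) :
    v ∈ EdgeEnd.component F r.edgeEnd ↔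
      r.HasTailIn F ((G.deleteEdges F).connectedComponentMk v) := by
  constructor
  · rintro ⟨s, hs, h⟩
    obtain ⟨C, h1, h2⟩ := (Quotient.exact hs : EdgeEquiv s r) F hF hE
    rwa [h.unique h1]
  · exact fun h => ⟨r, rfl, h⟩

/-- The vertex `v` edge-dominates the edge-end `ω`. -/
def EdgeDominates (v : V) (ω : EdgeEnd G) : Prop :=
  ∀ F : Set (Sym2 V), F.Finite → F ⊆ G.edgeSet → v ∈ EdgeEnd.component F ω

/-- A double ray `… v₋₁ v₀ v₁ …` of `G`: a two-way infinite path. -/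
structure DoubleRay (G : SimpleGraph V) where
  vert : ℤ → V
  injective : Function.Injective vert
  adj : ∀ n, G.Adj (vert n) (vert (n + 1))

/-- The subgraph formed by the vertices and edges of a double ray. -/
def DoubleRay.toSubgraph (R : DoubleRay G) : G.Subgraph where
  verts := Set.range R.vert
  Adj x y := ∃ n, s(x, y) = s(R.vert n, R.vert (n + 1))
  adj_sub := by
    rintro x y ⟨n, h⟩
    have := R.adj n
    rwa [← SimpleGraph.mem_edgeSet, ← h, SimpleGraph.mem_edgeSet] at this
  edge_vert := by
    rintro x y ⟨n, h⟩
    rcases Sym2.eq_iff.mp h with ⟨rfl, -⟩ | ⟨rfl, -⟩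
    · exact ⟨n, rfl⟩
    · exact ⟨n + 1, rfl⟩
  symm := ⟨fun x y ⟨n, h⟩ => ⟨n, by rw [Sym2.eq_swap]; exact h⟩⟩

/-- The half-ray `vₙ vₙ₊₁ vₙ₊₂ …` of a double ray. -/
def DoubleRay.forward (R : DoubleRay G) (n : ℤ) : Ray G where
  vert k := R.vert (n + k)
  injective := fun a b h => by
    have := R.injective h
    omega
  adj k := by
    have := R.adj (n + k)
    rwa [show n + (k : ℤ) + 1 = n + ((k + 1 : ℕ) : ℤ) by push_cast; ring] at this

/-- The half-ray `vₙ vₙ₋₁ vₙ₋₂ …` of a double ray. -/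
def DoubleRay.backward (R : DoubleRay G) (n : ℤ) : Ray G where
  vert k := R.vert (n - k)
  injective := fun a b h => by
    have := R.injective h
    omega
  adj k := by
    have := (R.adj (n - ((k + 1 : ℕ) : ℤ))).symm
    rwa [show n - ((k + 1 : ℕ) : ℤ) + 1 = n - k by push_cast; ring] at this

/-- `P` is a finite path of `G` with endpoints `v` and `w`. -/
def IsVertexPath (v w : V) (P : G.Subgraph) : Prop :=
  ∃ p : G.Walk v w, p.IsPath ∧ P = p.toSubgraph

/-- `P` is a `v – ω` path: a ray starting at `v` with edge-end `ω`, or a finite path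
from `v` to a vertex that edge-dominates `ω`. -/
def IsVertexEndPath (v : V) (ω : EdgeEnd G) (P : G.Subgraph) : Prop :=
  (∃ r : Ray G, r.vert 0 = v ∧ r.edgeEnd = ω ∧ P = r.toSubgraph) ∨
    ∃ w, EdgeDominates w ω ∧ IsVertexPath v w P

/-- `P` is an `ω₁ – ω₂` path: a `v – ωᵢ` path for some vertex `v` that edge-dominates the other
edge-end, or a double ray with one half-ray of edge-end `ω₁` and the other of edge-end `ω₂`. -/
def IsEndEndPath (ω₁ ω₂ : EdgeEnd G) (P : G.Subgraph) : Prop :=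
  (∃ v, EdgeDominates v ω₂ ∧ IsVertexEndPath v ω₁ P) ∨
  (∃ v, EdgeDominates v ω₁ ∧ IsVertexEndPath v ω₂ P) ∨
  ∃ (R : DoubleRay G) (n : ℤ), (R.backward n).edgeEnd = ω₁ ∧ (R.forward n).edgeEnd = ω₂ ∧
    P = R.toSubgraph

/-- `P` is an `A – B` path, for sets `A`, `B` of edge-ends. -/
def IsPathBetween (A B : Set (EdgeEnd G)) (P : G.Subgraph) : Prop :=
  ∃ a ∈ A, ∃ b ∈ B, IsEndEndPath a b P

/-- `F` is a finite set of edges of `G` such that `G ∖ F` contains no `A – B` path. -/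
def EdgeSeparates (F : Finset (Sym2 V)) (A B : Set (EdgeEnd G)) : Prop :=
  (F : Set (Sym2 V)) ⊆ G.edgeSet ∧
    ¬ ∃ P : G.Subgraph, IsPathBetween A B P ∧ Disjoint P.edgeSet (F : Set (Sym2 V))

end EdgeEnds

namespace EdgeEnds

open Filter SimpleGraph

/-! Edge-ends are handled through finite cuts, that is, vertex sets `Z` with finite `boundary G Z`:
every edge-end lies on one side of such a cut, and a vertex dominating it lies on the same side. An
`A`–`B` path must cross every finite cut between `A` and `B` (`IsEndEndPath.liesIn_iff`).
Conversely, since `A` and `B` are disjoint, a separating `F` contains all edges of some such cut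
(`exists_cut_of_edgeSeparates`). So `k = F.card` is the least size of a finite cut between `A` and
`B`.

By submodularity and a maximality argument, finite subsets of `A` and `B` already force every finite
cut between them to have at least `k` edges (`exists_finite_subset_forcing`).

For a finite set `T` of edge-ends, each dominated edge-end is represented by its dominating
vertices, and the undominated ones together by a cut `Z` of minimum boundary. Linking a nested
sequence of such cuts by Menger's theorem extends all boundary edges of `Z` to edge-disjoint rays
with edge-ends in `T` (`IsTight.exists_rays`). Dominating vertices and `Z` together form a `Hub`.

A finite cut between two hubs separates the edge-ends that they represent, so Menger's theorem
yields `k` edge-disjoint links between the hubs. A link whose endpoint is not dominating starts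
there with a boundary edge of `Z` and continues along the ray reserved for that edge, so the links
become edge-disjoint `A`–`B` paths. -/

/-- A path from `X` to `Y` that meets `X` only in its first and `Y` only in its last vertex. -/
structure Link {V : Type*} (G : SimpleGraph V) (X Y : Set V) where
  source : V
  target : V
  walk : G.Walk source target
  isPath : walk.IsPath
  source_mem : source ∈ X
  target_mem : target ∈ Y
  eq_source : ∀ v ∈ walk.support, v ∈ X → v = source
  eq_target : ∀ v ∈ walk.support, v ∈ Y → v = target

/-! ### Menger's theorem for edges, by integral flows -/

section Menger

variable {V : Type*} {G : SimpleGraph V} {X Y : Set V}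

/-- The entering boundary of `Z`: the ordered pairs that are edges from outside `Z` into `Z`. -/
def boundary (G : SimpleGraph V) (Z : Set V) : Set (V × V) :=
  {e | G.Adj e.1 e.2 ∧ e.1 ∉ Z ∧ e.2 ∈ Z}

theorem boundary_compl (Z : Set V) : boundary G Zᶜ = Prod.swap '' boundary G Z := by
  ext ⟨u, v⟩
  simp only [boundary, Set.mem_ofPred_eq, Set.mem_compl_iff, not_not, Set.mem_image, Prod.exists,
    Prod.swap_prod_mk, Prod.mk.injEq]
  constructor
  · rintro ⟨h, hu, hv⟩
    exact ⟨v, u, ⟨h.symm, hv, hu⟩, rfl, rfl⟩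
  · rintro ⟨a, b, ⟨h, ha, hb⟩, rfl, rfl⟩
    exact ⟨h.symm, hb, ha⟩

theorem encard_boundary_compl (Z : Set V) :
    (boundary G Zᶜ).encard = (boundary G Z).encard := by
  rw [boundary_compl, Prod.swap_injective.encard_image]

theorem finite_boundary_compl {Z : Set V} (h : (boundary G Z).Finite) :
    (boundary G Zᶜ).Finite := by
  rw [boundary_compl]
  exact h.image _

/-- Either there is an `X`–`Y` link along `Q`, or some set separates `X` from `Y` in `Q`. -/
theorem exists_link_or_closed (Q : V → V → Prop) :
    (∃ P : Link G X Y, ∀ d ∈ P.walk.darts, Q d.fst d.snd) ∨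
      ∃ R, X ⊆ R ∧ Disjoint R Y ∧ ∀ u ∈ R, ∀ v, v ∉ R → G.Adj u v → ¬ Q u v := by
  classical
  -- The reachable set of `Q`. Since the witnessing paths may meet `X` only at the start and `Y`
  -- only at the end, the first vertex of `Y` in `R` gives a `Link` directly.
  let R : Set V := {v | ∃ x ∈ X, ∃ p : G.Walk x v, p.IsPath ∧ (∀ d ∈ p.darts, Q d.fst d.snd) ∧
    (∀ w ∈ p.support, w ∈ X → w = x) ∧ ∀ w ∈ p.support, w ∈ Y → w = v}
  have hXR : X ⊆ R := fun x hx => ⟨x, hx, Walk.nil, by simp, by simp, by simp, by simp⟩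
  by_cases hR : Disjoint R Y
  · refine Or.inr ⟨R, hXR, hR, fun u hu v hv huv hQ => hv ?_⟩
    have huY : u ∉ Y := fun h => Set.disjoint_left.mp hR hu h
    obtain ⟨x, hx, p, hp, hd, h1, h2⟩ := hu
    have hpY : ∀ w ∈ p.support, w ∉ Y := fun w hw hwY => huY (h2 w hw hwY ▸ hwY)
    by_cases hvp : v ∈ p.support
    · refine ⟨x, hx, p.takeUntil v hvp, hp.takeUntil hvp, fun d hd' => hd d
        (p.darts_takeUntil_subset_darts hvp hd'), fun w hw => h1 w
        (p.support_takeUntil_subset_support hvp hw), fun w hw hwY =>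
        absurd hwY (hpY w (p.support_takeUntil_subset_support hvp hw))⟩
    · refine ⟨x, hx, p.concat huv, hp.concat hvp huv, fun d hd' => ?_, fun w hw hwX => ?_,
        fun w hw hwY => ?_⟩
      · rw [Walk.darts_concat, List.concat_eq_append, List.mem_append, List.mem_singleton] at hd'
        rcases hd' with hd' | rfl
        · exact hd d hd'
        · exact hQ
      · rw [Walk.support_concat, List.mem_append, List.mem_singleton] at hw
        rcases hw with hw | rfl
        · exact h1 w hw hwX
        · exact absurd (hXR hwX) hv
      · rw [Walk.support_concat, List.mem_append, List.mem_singleton] at hw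
        rcases hw with hw | rfl
        · exact absurd hwY (hpY w hw)
        · rfl
  · obtain ⟨y, ⟨x, hx, p, hp, hd, h1, h2⟩, hy⟩ := Set.not_disjoint_iff.mp hR
    exact Or.inl ⟨⟨x, y, p, hp, hx, hy, h1, h2⟩, hd⟩

open Classical in
/-- The net amount of `f` leaving `W`. -/
noncomputable def netOut (f : Finset (V × V)) (W : Set V) : ℤ :=
  ∑ e ∈ f, ((if e.1 ∈ W then 1 else 0) - (if e.2 ∈ W then 1 else 0))

/-- `f` is a set of oriented edges of `G`. -/
def IsOriented (G : SimpleGraph V) (f : Finset (V × V)) : Prop :=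
  ∀ e ∈ f, G.Adj e.1 e.2 ∧ e.swap ∉ f

/-- `f` is an integral flow from `X` to `Y` of value `c`. -/
def IsFlow (G : SimpleGraph V) (X Y : Set V) (f : Finset (V × V)) (c : ℕ) : Prop :=
  IsOriented G f ∧ ∀ W, X ⊆ W → Disjoint W Y → netOut f W = c

open Classical in
-- One unit is pushed along `p`: a dart whose reverse carries flow cancels it, and any other dart is
-- added. Agreement off `p` feeds the induction: the rest of the path does not revisit `x`, so it
-- has not touched the first edge.
theorem exists_augment {x y : V} (p : G.Walk x y) (hp : p.IsPath) {f : Finset (V × V)}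
    (hf : IsOriented G f) (hpf : ∀ d ∈ p.darts, d.toProd ∉ f) :
    ∃ f', IsOriented G f' ∧ (∀ e : V × V, s(e.1, e.2) ∉ p.edges → (e ∈ f' ↔ e ∈ f)) ∧
      ∀ W : Set V, netOut f' W =
        netOut f W + (if x ∈ W then 1 else 0) - (if y ∈ W then 1 else 0) := by
  induction p with
  | nil => exact ⟨f, hf, fun _ _ => Iff.rfl, fun W => by ring⟩
  | @cons x v y h p ih =>
    have hxp : x ∉ p.support := ((Walk.cons_isPath_iff h p).mp hp).2
    obtain ⟨f', hf', hag, hnet⟩ := ih ((Walk.cons_isPath_iff h p).mp hp).1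
      fun d hd => hpf d (by simp [hd])
    have hedge : s(x, v) ∉ p.edges := fun he => hxp (p.fst_mem_support_of_mem_edges he)
    have h1 : (x, v) ∉ f' := by
      rw [hag (x, v) hedge]
      exact hpf ⟨(x, v), h⟩ (by simp)
    by_cases h2 : (v, x) ∈ f'
    · refine ⟨f'.erase (v, x), fun e he => ?_, fun e he => ?_, fun W => ?_⟩
      · have he' := Finset.mem_of_mem_erase he
        exact ⟨(hf' e he').1, fun h => (hf' e he').2 (Finset.mem_of_mem_erase h)⟩
      · rw [Walk.edges_cons, List.mem_cons, not_or] at he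
        rw [Finset.mem_erase, ← hag e he.2]
        refine ⟨fun h => h.2, fun h => ⟨?_, h⟩⟩
        rintro rfl
        exact he.1 Sym2.eq_swap
      · have := Finset.sum_erase_add (s := f') (a := (v, x))
          (f := fun e : V × V => ((if e.1 ∈ W then 1 else 0) - (if e.2 ∈ W then 1 else 0) : ℤ)) h2
        have h3 := hnet W
        simp only [netOut] at h3 ⊢
        linarith
    · refine ⟨insert (x, v) f', fun e he => ?_, fun e he => ?_, fun W => ?_⟩
      · rw [Finset.mem_insert] at he ⊢
        rcases he with rfl | he
        · refine ⟨h, fun h' => ?_⟩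
          rcases h' with h' | h'
          · exact h.ne (Prod.mk.inj h').2
          · exact h2 h'
        · refine ⟨(hf' e he).1, fun h' => ?_⟩
          rcases h' with h' | h'
          · exact h2 (by rwa [← Prod.swap_swap e, h'] at he)
          · exact (hf' e he).2 h'
      · rw [Walk.edges_cons, List.mem_cons, not_or] at he
        rw [Finset.mem_insert, ← hag e he.2]
        refine ⟨fun h => h.resolve_left ?_, Or.inr⟩
        rintro rfl
        exact he.1 rfl
      · have h3 := hnet W
        simp only [netOut] at h3 ⊢
        rw [Finset.sum_insert h1, h3]
        ring

open Classical in
theorem exists_peel {x y : V} (p : G.Walk x y) (hp : p.IsPath) {f : Finset (V × V)}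
    (hpf : ∀ d ∈ p.darts, d.toProd ∈ f) :
    ∃ f', (∀ e : V × V, e ∈ f' ↔ e ∈ f ∧ ∀ d ∈ p.darts, d.toProd ≠ e) ∧
      ∀ W : Set V, netOut f' W =
        netOut f W - (if x ∈ W then 1 else 0) + (if y ∈ W then 1 else 0) := by
  induction p with
  | nil => exact ⟨f, by simp, fun W => by ring⟩
  | @cons x v y h p ih =>
    have hxp : x ∉ p.support := ((Walk.cons_isPath_iff h p).mp hp).2
    obtain ⟨f', hf', hnet⟩ := ih ((Walk.cons_isPath_iff h p).mp hp).1
      fun d hd => hpf d (by simp [hd])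
    have h1 : (x, v) ∈ f' := by
      refine (hf' _).mpr ⟨hpf ⟨(x, v), h⟩ (by simp), fun d hd hd' => hxp ?_⟩
      have := p.dart_fst_mem_support_of_mem_darts hd
      rwa [show d.fst = x from congrArg Prod.fst hd'] at this
    refine ⟨f'.erase (x, v), fun e => ?_, fun W => ?_⟩
    · rw [Finset.mem_erase, hf', Walk.darts_cons]
      simp only [List.mem_cons, forall_eq_or_imp, ne_eq]
      exact ⟨fun h => ⟨h.2.1, fun h' => h.1 h'.symm, h.2.2⟩,
        fun h => ⟨fun h' => h.2.1 h'.symm, h.1, h.2.2⟩⟩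
    · have := Finset.sum_erase_add (s := f') (a := (x, v))
        (f := fun e : V × V => ((if e.1 ∈ W then 1 else 0) - (if e.2 ∈ W then 1 else 0) : ℤ)) h1
      have h3 := hnet W
      simp only [netOut] at h3 ⊢
      linarith

/-- Augmenting paths in the style of Ford and Fulkerson. If no path along unsaturated darts exists,
a closed set `R` has all its outgoing edges saturated and no flow entering. The value of the flow is
then the size of the cut, which is too large. -/
theorem exists_isFlow (k : ℕ)
    (hk : ∀ W, X ⊆ W → Disjoint W Y → (k : ℕ∞) ≤ (boundary G W).encard) :
    ∃ f, IsFlow G X Y f k := by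
  classical
  induction k with
  | zero => exact ⟨∅, by simp [IsOriented], by simp [netOut]⟩
  | succ c ih =>
    obtain ⟨f, hf, hc⟩ := ih fun W h1 h2 => le_trans (by simp) (hk W h1 h2)
    rcases exists_link_or_closed (G := G) (X := X) (Y := Y) (fun u v => (u, v) ∉ f) with ⟨P, hP⟩ | ⟨R, h1, h2, h3⟩
    · obtain ⟨f', hf', -, hnet⟩ := exists_augment P.walk P.isPath hf hP
      refine ⟨f', hf', fun W hW hWY => ?_⟩
      rw [hnet, hc W hW hWY, if_pos (hW P.source_mem),
        if_neg (fun h => Set.disjoint_left.mp hWY h P.target_mem)]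
      push_cast
      ring
    · exfalso
      have hall : ∀ u ∈ R, ∀ v, v ∉ R → G.Adj u v → (u, v) ∈ f := fun u hu v hv huv =>
        not_not.mp (h3 u hu v hv huv)
      have hsub : boundary G Rᶜ ⊆ (f.filter fun e => e.1 ∈ R ∧ e.2 ∉ R : Finset (V × V)) := by
        rintro ⟨u, v⟩ ⟨ha, hu, hv⟩
        have hu : u ∈ R := not_not.mp hu
        simpa [hu] using ⟨hall u hu v hv ha, hv⟩
      have hle := (hk R h1 h2).trans_eq (encard_boundary_compl R).symm
      have hle := hle.trans (Set.encard_le_encard hsub)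
      rw [Set.encard_coe_eq_coe_finsetCard, Nat.cast_le] at hle
      have hnet := hc R h1 h2
      have : netOut f R = ((f.filter fun e => e.1 ∈ R ∧ e.2 ∉ R).card : ℤ) := by
        rw [Finset.card_filter, netOut]
        push_cast
        refine Finset.sum_congr rfl fun e he => ?_
        by_cases ha : e.1 ∈ R <;> by_cases hb : e.2 ∈ R <;> simp [ha, hb]
        -- Flow entering `R` would share its edge with the saturated dart leaving `R`, against
        -- orientation.
        exact (hf e he).2 (hall e.2 hb e.1 ha (hf e he).1.symm)
      omega

/-- Paths are peeled off one at a time. Positive value guarantees a path along `f`, as otherwise no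
flow would leave some set containing `X` and avoiding `Y`. -/
theorem IsFlow.exists_links {k : ℕ} {f : Finset (V × V)}
    (hf : IsFlow G X Y f k) :
    ∃ P : Fin k → Link G X Y, (∀ i, ∀ d ∈ (P i).walk.darts, d.toProd ∈ f) ∧
      ∀ i j, i ≠ j → ∀ d ∈ (P i).walk.darts, d ∉ (P j).walk.darts := by
  classical
  induction k generalizing f with
  | zero => exact ⟨fun i => i.elim0, fun i => i.elim0, fun i => i.elim0⟩
  | succ c ih =>
    obtain ⟨hf, hc⟩ := hf
    rcases exists_link_or_closed (G := G) (X := X) (Y := Y) (fun u v => (u, v) ∈ f) with ⟨P, hP⟩ | ⟨R, h1, h2, h3⟩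
    · obtain ⟨f', hf', hnet⟩ := exists_peel P.walk P.isPath hP
      obtain ⟨Ps, hPs, hd⟩ := ih (f := f') ⟨fun e he => ⟨(hf e ((hf' e).mp he).1).1, fun h =>
        (hf e ((hf' e).mp he).1).2 ((hf' _).mp h).1⟩, fun W hW hWY => by
          rw [hnet, hc W hW hWY, if_pos (hW P.source_mem),
            if_neg (fun h => Set.disjoint_left.mp hWY h P.target_mem)]
          push_cast
          ring⟩
      have key : ∀ i, ∀ d ∈ (Ps i).walk.darts, d ∉ P.walk.darts := fun i d hd hd' =>
        ((hf' _).mp (hPs i d hd)).2 d hd' rfl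
      refine ⟨Fin.cons P Ps, fun i => ?_, fun i j hij => ?_⟩
      · refine Fin.cases ?_ (fun i => ?_) i
        · exact hP
        · exact fun d hd => ((hf' _).mp (hPs i d hd)).1
      · revert hij
        refine Fin.cases ?_ (fun i => ?_) i <;> refine Fin.cases ?_ (fun j => ?_) j
        · exact fun h => absurd rfl h
        · exact fun _ d h1 h2 => key j d h2 h1
        · exact fun _ => key i
        · exact fun h => hd i j fun h' => h (congrArg _ h')
    · exfalso
      have hnet := hc R h1 h2
      have : netOut f R ≤ 0 := by
        refine Finset.sum_nonpos fun e he => ?_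
        have := fun ha hb => h3 e.1 ha e.2 hb (hf e he).1 he
        by_cases ha : e.1 ∈ R <;> by_cases hb : e.2 ∈ R <;> simp [ha, hb]
        exact this ha hb
      omega

/-- The edge version of Menger's theorem, for a finite number of paths in an arbitrary graph. -/
theorem exists_edgeDisjoint_links (k : ℕ)
    (hk : ∀ W, X ⊆ W → Disjoint W Y → (k : ℕ∞) ≤ (boundary G W).encard) :
    ∃ P : Fin k → Link G X Y, ∀ i j, i ≠ j → ∀ e ∈ (P i).walk.edges, e ∉ (P j).walk.edges := by
  obtain ⟨f, hf⟩ := exists_isFlow k hk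
  obtain ⟨P, hP, hd⟩ := hf.exists_links
  refine ⟨P, fun i j hij e he he' => ?_⟩
  obtain ⟨d, hdi, rfl⟩ := List.mem_map.mp he
  obtain ⟨d', hdj, hdd⟩ := List.mem_map.mp he'
  -- A common edge is either a common dart, excluded by disjointness, or a pair of opposite darts of
  -- `f`, excluded by orientation.
  rcases SimpleGraph.dart_edge_eq_iff _ _ |>.mp hdd with rfl | rfl
  · exact hd i j hij _ hdi hdj
  · exact (hf.1 _ (hP i d hdi)).2 (hP j _ hdj)

end Menger

/-! ### Finite cuts and the side on which an edge-end lies -/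

section Cuts

variable {V : Type*} {G : SimpleGraph V}

theorem finite_boundary_inter {Z W : Set V} (hZ : (boundary G Z).Finite)
    (hW : (boundary G W).Finite) : (boundary G (Z ∩ W)).Finite := by
  refine (hZ.union hW).subset ?_
  rintro e ⟨h, h1, h2, h3⟩
  by_cases h4 : e.1 ∈ Z
  · exact Or.inr ⟨h, fun h5 => h1 ⟨h4, h5⟩, h3⟩
  · exact Or.inl ⟨h, h4, h2⟩

theorem finite_boundary_union {Z W : Set V} (hZ : (boundary G Z).Finite)
    (hW : (boundary G W).Finite) : (boundary G (Z ∪ W)).Finite := by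
  refine (hZ.union hW).subset ?_
  rintro e ⟨h, h1, h2 | h2⟩
  · exact Or.inl ⟨h, fun h5 => h1 (Or.inl h5), h2⟩
  · exact Or.inr ⟨h, fun h5 => h1 (Or.inr h5), h2⟩

/-- Comparing unions and intersections of the two boundaries avoids subtraction, so infinite
boundaries need no separate treatment. -/
theorem encard_boundary_submodular (Z W : Set V) :
    (boundary G (Z ∩ W)).encard + (boundary G (Z ∪ W)).encard ≤
      (boundary G Z).encard + (boundary G W).encard := by
  rw [← Set.encard_union_add_encard_inter, ← Set.encard_union_add_encard_inter (boundary G Z)]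
  refine add_le_add (Set.encard_le_encard ?_) (Set.encard_le_encard ?_)
  · rintro e (⟨h, h1, h2, h3⟩ | ⟨h, h1, h2 | h2⟩)
    · by_cases h4 : e.1 ∈ Z
      · exact Or.inr ⟨h, fun h5 => h1 ⟨h4, h5⟩, h3⟩
      · exact Or.inl ⟨h, h4, h2⟩
    · exact Or.inl ⟨h, fun h5 => h1 (Or.inl h5), h2⟩
    · exact Or.inr ⟨h, fun h5 => h1 (Or.inr h5), h2⟩
  · rintro e ⟨⟨h, -, h2, h3⟩, -, h1, -⟩
    exact ⟨⟨h, fun h4 => h1 (Or.inl h4), h2⟩, h, fun h4 => h1 (Or.inr h4), h3⟩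

/-- The edges between `Z` and its complement. -/
def cutEdges (G : SimpleGraph V) (Z : Set V) : Set (Sym2 V) :=
  (fun e : V × V => s(e.1, e.2)) '' boundary G Z

theorem cutEdges_subset (Z : Set V) : cutEdges G Z ⊆ G.edgeSet := by
  rintro _ ⟨e, he, rfl⟩
  exact he.1

theorem mem_cutEdges {Z : Set V} {u v : V} (h : G.Adj u v) (hu : u ∉ Z) (hv : v ∈ Z) :
    s(u, v) ∈ cutEdges G Z :=
  ⟨(u, v), ⟨h, hu, hv⟩, rfl⟩

theorem injOn_boundary (Z : Set V) :
    Set.InjOn (fun e : V × V => s(e.1, e.2)) (boundary G Z) := by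
  rintro ⟨u, v⟩ ⟨-, hu, hv⟩ ⟨a, b⟩ ⟨-, ha, hb⟩ h
  rcases Sym2.eq_iff.mp h with ⟨rfl, rfl⟩ | ⟨rfl, rfl⟩
  · rfl
  · exact absurd hb hu

theorem encard_cutEdges (Z : Set V) : (cutEdges G Z).encard = (boundary G Z).encard :=
  (injOn_boundary Z).encard_image

theorem mem_iff_of_adj {Z : Set V} {u v : V} (h : G.Adj u v) (he : s(u, v) ∉ cutEdges G Z) :
    u ∈ Z ↔ v ∈ Z := by
  refine ⟨fun hu => ?_, fun hv => ?_⟩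
  · by_contra hv
    exact he (Sym2.eq_swap ▸ mem_cutEdges h.symm hv hu)
  · by_contra hu
    exact he (mem_cutEdges h hu hv)

theorem mem_iff_of_walk {Z : Set V} {u v : V} (p : G.Walk u v)
    (hp : ∀ e ∈ p.edges, e ∉ cutEdges G Z) : u ∈ Z ↔ v ∈ Z := by
  induction p with
  | nil => rfl
  | cons h p ih =>
    exact (mem_iff_of_adj h (hp _ (by simp))).trans (ih fun e he => hp e (by simp [he]))

theorem mem_iff_of_reachable_deleteEdges {Z : Set V} {F : Set (Sym2 V)} (hF : cutEdges G Z ⊆ F)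
    {u v : V} (h : (G.deleteEdges F).Reachable u v) : u ∈ Z ↔ v ∈ Z := by
  obtain ⟨p⟩ := h
  induction p with
  | nil => rfl
  | cons h p ih =>
    rw [deleteEdges_adj] at h
    exact (mem_iff_of_adj h.1 fun h' => h.2 (hF h')).trans ih

theorem Ray.eventually_not_mem_boundary (r : Ray G) {Z : Set V} (hZ : (boundary G Z).Finite) :
    ∀ᶠ n in atTop, s(r.vert n, r.vert (n + 1)) ∉ cutEdges G Z := by
  obtain ⟨C, N, hN⟩ := r.exists_hasTailIn (hZ.image fun e : V × V => s(e.1, e.2))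
  filter_upwards [eventually_ge_atTop N] with n hn
  exact ((deleteEdges_adj).mp (hN n hn).1).2

theorem Ray.eventually_mem_of_frequently (r : Ray G) {Z : Set V} (hZ : (boundary G Z).Finite)
    (h : ∃ᶠ n in atTop, r.vert n ∈ Z) : ∀ᶠ n in atTop, r.vert n ∈ Z := by
  obtain ⟨N, hN⟩ := eventually_atTop.mp (r.eventually_not_mem_boundary hZ)
  obtain ⟨M, hM, hMZ⟩ := (frequently_atTop.mp h) N
  filter_upwards [eventually_ge_atTop M] with n hn
  induction n, hn using Nat.le_induction with
  | base => exact hMZ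
  | succ n hn ih => exact (mem_iff_of_adj (r.adj n) (hN n (hM.trans hn))).mp ih

/-- A component of `G ∖ F` is itself a finite cut, all its boundary edges being in `F`. Meeting it
frequently is enough, because a ray eventually stays in one component. -/
theorem edgeEnd_eq_of_forall_cut {r s : Ray G}
    (h : ∀ Z : Set V, (boundary G Z).Finite → (∀ᶠ n in atTop, r.vert n ∈ Z) →
      ∃ᶠ n in atTop, s.vert n ∈ Z) : r.edgeEnd = s.edgeEnd := by
  refine Quotient.sound fun F hF _ => ?_
  obtain ⟨C, N, hC⟩ := r.exists_hasTailIn hF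
  obtain ⟨D, M, hD⟩ := s.exists_hasTailIn hF
  have hcut : cutEdges G {v | (G.deleteEdges F).connectedComponentMk v = C} ⊆ F := by
    rintro _ ⟨⟨u, v⟩, ⟨hadj, hu, hv⟩, rfl⟩
    by_contra hF'
    refine hu (Eq.trans ?_ hv)
    exact ConnectedComponent.eq.mpr (Adj.reachable (deleteEdges_adj.mpr ⟨hadj, hF'⟩))
  have hfin : (boundary G {v | (G.deleteEdges F).connectedComponentMk v = C}).Finite :=
    (hF.subset hcut).of_finite_image (injOn_boundary _)
  obtain ⟨n, hn, hnC⟩ := frequently_atTop.mp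
    (h _ hfin (eventually_atTop.mpr ⟨N, fun n hn => (hC n hn).2⟩)) M
  exact ⟨C, ⟨N, hC⟩, M, fun m hm => ⟨(hD m hm).1, (hD m hm).2.trans ((hD n hn).2.symm.trans hnC)⟩⟩

theorem eventually_mem_of_edgeEnd_eq {r s : Ray G} (h : r.edgeEnd = s.edgeEnd) {Z : Set V}
    (hZ : (boundary G Z).Finite) (hr : ∀ᶠ n in atTop, r.vert n ∈ Z) :
    ∀ᶠ n in atTop, s.vert n ∈ Z := by
  obtain ⟨C, ⟨N, hN⟩, M, hM⟩ := (Quotient.exact h : EdgeEquiv r s) (cutEdges G Z)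
    (hZ.image _) (cutEdges_subset Z)
  obtain ⟨n, hn, hnZ⟩ := ((eventually_ge_atTop N).and hr).exists
  filter_upwards [eventually_ge_atTop M] with m hm
  exact (mem_iff_of_reachable_deleteEdges subset_rfl
    (ConnectedComponent.eq.mp ((hN n hn).2.trans (hM m hm).2.symm))).mp hnZ

/-- A chosen ray of an edge-end. -/
noncomputable def EdgeEnd.rep (ω : EdgeEnd G) : Ray G := Quotient.out (s := edgeSetoid G) ω

@[simp]
theorem EdgeEnd.edgeEnd_rep (ω : EdgeEnd G) : ω.rep.edgeEnd = ω :=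
  Quotient.out_eq (s := edgeSetoid G) ω

/-- The chosen ray of `ω` has a tail in `Z`. For a finite cut this is independent of the choice. -/
def EdgeEnd.LiesIn (ω : EdgeEnd G) (Z : Set V) : Prop := ∀ᶠ n in atTop, ω.rep.vert n ∈ Z

theorem EdgeEnd.LiesIn.mono {ω : EdgeEnd G} {Z W : Set V} (h : ω.LiesIn Z) (hZW : Z ⊆ W) :
    ω.LiesIn W :=
  Eventually.mono h fun _ hn => hZW hn

theorem EdgeEnd.LiesIn.inter {ω : EdgeEnd G} {Z W : Set V} (hZ : ω.LiesIn Z) (hW : ω.LiesIn W) :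
    ω.LiesIn (Z ∩ W) :=
  Eventually.and hZ hW

theorem EdgeEnd.LiesIn.not_compl {ω : EdgeEnd G} {Z : Set V} (h : ω.LiesIn Z) :
    ¬ ω.LiesIn Zᶜ := fun h' => by
  obtain ⟨n, h1, h2⟩ := (Eventually.and h h').exists
  exact h2 h1

theorem EdgeEnd.liesIn_compl {ω : EdgeEnd G} {Z : Set V} (hZ : (boundary G Z).Finite) :
    ω.LiesIn Zᶜ ↔ ¬ ω.LiesIn Z := by
  refine ⟨fun h h' => h'.not_compl h, fun h => ?_⟩
  by_contra h'
  exact h (ω.rep.eventually_mem_of_frequently hZ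
    (Frequently.mono (not_eventually.mp h') fun _ => not_not.mp))

theorem liesIn_edgeEnd_iff {r : Ray G} {Z : Set V} (hZ : (boundary G Z).Finite) :
    r.edgeEnd.LiesIn Z ↔ ∀ᶠ n in atTop, r.vert n ∈ Z :=
  ⟨eventually_mem_of_edgeEnd_eq r.edgeEnd.edgeEnd_rep hZ,
    eventually_mem_of_edgeEnd_eq r.edgeEnd.edgeEnd_rep.symm hZ⟩

theorem EdgeEnd.cutEdges_component_subset (F : Set (Sym2 V)) (ω : EdgeEnd G) :
    cutEdges G (EdgeEnd.component F ω) ⊆ F := by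
  rintro _ ⟨⟨u, v⟩, ⟨hadj, hu, r, hr, hv⟩, rfl⟩
  by_contra hF
  refine hu ⟨r, hr, ?_⟩
  rwa [show (G.deleteEdges F).connectedComponentMk u = (G.deleteEdges F).connectedComponentMk v from
    ConnectedComponent.eq.mpr (Adj.reachable (deleteEdges_adj.mpr ⟨hadj, hF⟩))]

theorem finite_boundary_of_cutEdges {Z : Set V} (h : (cutEdges G Z).Finite) :
    (boundary G Z).Finite :=
  h.of_finite_image (injOn_boundary _)

theorem EdgeEnd.liesIn_component {F : Set (Sym2 V)} (hF : F.Finite) (ω : EdgeEnd G) :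
    ω.LiesIn (EdgeEnd.component F ω) := by
  obtain ⟨C, N, hN⟩ := ω.rep.exists_hasTailIn hF
  refine eventually_atTop.mpr ⟨N, fun n hn => ⟨ω.rep, ω.edgeEnd_rep, N, fun m hm => ?_⟩⟩
  exact ⟨(hN m hm).1, (hN m hm).2.trans (hN n hn).2.symm⟩

theorem EdgeDominates.liesIn {v : V} {ω : EdgeEnd G} (h : EdgeDominates v ω) {Z : Set V}
    (hZ : (boundary G Z).Finite) (hv : v ∈ Z) : ω.LiesIn Z := by
  obtain ⟨r, rfl, N, hN⟩ := h (cutEdges G Z) (hZ.image _) (cutEdges_subset Z)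
  rw [liesIn_edgeEnd_iff hZ]
  filter_upwards [eventually_ge_atTop N] with n hn
  exact (mem_iff_of_reachable_deleteEdges subset_rfl (ConnectedComponent.eq.mp (hN n hn).2)).mpr hv

theorem EdgeDominates.mem {v : V} {ω : EdgeEnd G} (h : EdgeDominates v ω) {Z : Set V}
    (hZ : (boundary G Z).Finite) (hω : ω.LiesIn Z) : v ∈ Z := by
  by_contra hv
  exact hω.not_compl (h.liesIn (finite_boundary_compl hZ) hv)

theorem exists_cut_of_not_edgeDominates {v : V} {ω : EdgeEnd G} (h : ¬ EdgeDominates v ω) :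
    ∃ Z, (boundary G Z).Finite ∧ ω.LiesIn Z ∧ v ∉ Z := by
  simp only [EdgeDominates, not_forall] at h
  obtain ⟨F, hF, -, hv⟩ := h
  exact ⟨_, finite_boundary_of_cutEdges (hF.subset (EdgeEnd.cutEdges_component_subset F ω)),
    EdgeEnd.liesIn_component hF ω, hv⟩

end Cuts

/-! ### Joining paths and rays -/

section Gluing

variable {V : Type*} {G : SimpleGraph V}

theorem Ray.ext_vert {r s : Ray G} (h : ∀ n, r.vert n = s.vert n) : r = s := by
  cases r
  cases s
  simpa using funext h

/-- The tail of a ray starting at its `N`-th vertex. -/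
def Ray.drop (r : Ray G) (N : ℕ) : Ray G where
  vert n := r.vert (N + n)
  injective := fun a b h => by
    have := r.injective h
    omega
  adj n := r.adj (N + n)

theorem Ray.edgeEnd_drop (r : Ray G) (N : ℕ) : (r.drop N).edgeEnd = r.edgeEnd := by
  refine (edgeEnd_eq_of_forall_cut fun Z _ h => ?_).symm
  refine Eventually.frequently ?_
  obtain ⟨M, hM⟩ := eventually_atTop.mp h
  exact eventually_atTop.mpr ⟨M, fun n hn => hM _ (by omega)⟩

theorem Ray.mem_edgeSet_toSubgraph (r : Ray G) {e : Sym2 V} :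
    e ∈ r.toSubgraph.edgeSet ↔ ∃ n, e = s(r.vert n, r.vert (n + 1)) := by
  induction e with | _ x y => rfl

theorem DoubleRay.mem_edgeSet_toSubgraph (r : DoubleRay G) {e : Sym2 V} :
    e ∈ r.toSubgraph.edgeSet ↔ ∃ n, e = s(r.vert n, r.vert (n + 1)) := by
  induction e with | _ x y => rfl

/-- The ray obtained by putting a new vertex in front. -/
def Ray.cons (v : V) (r : Ray G) (h : G.Adj v (r.vert 0)) (hv : ∀ n, r.vert n ≠ v) : Ray G where
  vert n := Nat.casesOn n v r.vert
  injective := by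
    rintro (_ | a) (_ | b) h
    · rfl
    · exact absurd h.symm (hv b)
    · exact absurd h (hv a)
    · exact congrArg _ (r.injective h)
  adj n := by
    cases n with
    | zero => exact h
    | succ n => exact r.adj n

/-- A path that meets a ray only in the first vertex of the ray can be put in front of it. -/
theorem Ray.exists_prepend {v w : V} (p : G.Walk v w) (hp : p.IsPath) (r : Ray G)
    (hr : r.vert 0 = w) (hpr : ∀ n, r.vert n ∈ p.support → n = 0) :
    ∃ s : Ray G, s.vert 0 = v ∧ s.edgeEnd = r.edgeEnd ∧
      (∀ n, s.vert n ∈ p.support ∨ ∃ m, s.vert n = r.vert m) ∧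
      ∀ n, s(s.vert n, s.vert (n + 1)) ∈ p.edges ∨
        ∃ m, s(s.vert n, s.vert (n + 1)) = s(r.vert m, r.vert (m + 1)) := by
  induction p with
  | nil => exact ⟨r, hr, rfl, fun n => Or.inr ⟨n, rfl⟩, fun n => Or.inr ⟨n, rfl⟩⟩
  | @cons v u w h p ih =>
    obtain ⟨hp, hv⟩ := (Walk.cons_isPath_iff h p).mp hp
    obtain ⟨s, hs0, hsr, hs, hse⟩ := ih hp hr fun n hn => hpr n (by simp [hn])
    have hvs : ∀ n, s.vert n ≠ v := by
      intro n hn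
      rcases hs n with h' | ⟨m, h'⟩
      · exact hv (hn ▸ h')
      · have hm := hpr m (by rw [← h', hn]; simp)
        rw [hm, hr, hn] at h'
        exact hv (h' ▸ p.end_mem_support)
    refine ⟨s.cons v (hs0 ▸ h) hvs, rfl, ?_, ?_, ?_⟩
    · rw [← hsr, ← Ray.edgeEnd_drop _ 1]
      refine congrArg _ (Ray.ext_vert fun n => ?_)
      simp only [Ray.drop, Ray.cons]
      rw [add_comm]
    · rintro (_ | n)
      · exact Or.inl (by simp [Ray.cons])
      · exact (hs n).imp (fun h' => by simpa [Ray.cons] using Or.inr h') id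
    · rintro (_ | n)
      · exact Or.inl (by simp [Ray.cons, hs0])
      · exact (hse n).imp (fun h' => by simpa [Ray.cons] using Or.inr h') id

/-- Two rays that meet only in their common first vertex form a double ray. -/
theorem exists_doubleRay (r s : Ray G) (h0 : r.vert 0 = s.vert 0)
    (hrs : ∀ i j, r.vert i = s.vert j → j = 0) :
    ∃ R : DoubleRay G, (R.backward 0).edgeEnd = r.edgeEnd ∧ (R.forward 0).edgeEnd = s.edgeEnd ∧
      ∀ e ∈ R.toSubgraph.edgeSet, e ∈ r.toSubgraph.edgeSet ∨ e ∈ s.toSubgraph.edgeSet := by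
  let f : ℤ → V := fun n => if 0 ≤ n then s.vert n.toNat else r.vert (-n).toNat
  have fs : ∀ n : ℕ, f n = s.vert n := fun n => by simp [f]
  have fr : ∀ n : ℕ, f (-n) = r.vert n := fun n => by
    by_cases hn : n = 0
    · simp [f, hn, h0]
    · simp [f, hn]
  have hcases : ∀ n : ℤ, (∃ m : ℕ, n = m) ∨ ∃ m : ℕ, n = -((m + 1 : ℕ) : ℤ) := fun n => by
    rcases le_or_gt 0 n with h | h
    · exact Or.inl ⟨n.toNat, by omega⟩
    · exact Or.inr ⟨(-n).toNat - 1, by omega⟩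
  have hinj : Function.Injective f := by
    intro a b hab
    rcases hcases a with ⟨m, rfl⟩ | ⟨m, rfl⟩ <;> rcases hcases b with ⟨k, rfl⟩ | ⟨k, rfl⟩
    · rw [fs, fs] at hab
      rw [s.injective hab]
    · rw [fs, fr] at hab
      have hm := hrs _ _ hab.symm
      rw [hm, ← h0] at hab
      exact absurd (r.injective hab) (by omega)
    · rw [fs, fr] at hab
      have hm := hrs _ _ hab
      rw [hm, ← h0] at hab
      exact absurd (r.injective hab) (by omega)
    · rw [fr, fr] at hab
      rw [r.injective hab]
  have hstep : ∀ n : ℤ, (∃ m, f n = s.vert m ∧ f (n + 1) = s.vert (m + 1)) ∨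
      ∃ m, f n = r.vert (m + 1) ∧ f (n + 1) = r.vert m := by
    intro n
    rcases hcases n with ⟨m, rfl⟩ | ⟨m, rfl⟩
    · exact Or.inl ⟨m, fs m, by exact_mod_cast fs (m + 1)⟩
    · refine Or.inr ⟨m, fr (m + 1), ?_⟩
      rw [← fr m]
      congr 1
      push_cast
      ring
  let R : DoubleRay G := ⟨f, hinj, fun n => by
    rcases hstep n with ⟨m, h1, h2⟩ | ⟨m, h1, h2⟩
    · rw [h1, h2]; exact s.adj m
    · rw [h1, h2]; exact (r.adj m).symm⟩
  refine ⟨R, ?_, ?_, fun e he => ?_⟩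
  · refine congrArg _ (Ray.ext_vert fun n => ?_)
    rw [← fr n]
    simp [DoubleRay.backward, R]
  · refine congrArg _ (Ray.ext_vert fun n => ?_)
    rw [← fs n]
    simp [DoubleRay.forward, R]
  · obtain ⟨n, rfl⟩ := R.mem_edgeSet_toSubgraph.mp he
    rcases hstep n with ⟨m, h1, h2⟩ | ⟨m, h1, h2⟩
    · exact Or.inr (s.mem_edgeSet_toSubgraph.mpr ⟨m, by simp [R, h1, h2]⟩)
    · refine Or.inl (r.mem_edgeSet_toSubgraph.mpr ⟨m, ?_⟩)
      rw [Sym2.eq_swap]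
      simp [R, h1, h2]

end Gluing

/-! ### Separating edge sets versus finite cuts, and reduction to finitely many edge-ends -/

section Separation

variable {V : Type*} {G : SimpleGraph V}

/-- Two disjoint rays joined by a path form a double ray. -/
theorem exists_doubleRay_of_path {v w : V} (p : G.Walk v w) (hp : p.IsPath) (r s : Ray G)
    (hr : r.vert 0 = v) (hs : s.vert 0 = w) (hpr : ∀ n, r.vert n ∈ p.support → n = 0)
    (hps : ∀ n, s.vert n ∈ p.support → n = 0) (hrs : ∀ i j, r.vert i ≠ s.vert j) :
    ∃ R : DoubleRay G, (R.backward 0).edgeEnd = r.edgeEnd ∧ (R.forward 0).edgeEnd = s.edgeEnd ∧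
      ∀ e ∈ R.toSubgraph.edgeSet,
        e ∈ p.edges ∨ e ∈ r.toSubgraph.edgeSet ∨ e ∈ s.toSubgraph.edgeSet := by
  obtain ⟨s', hs0, hss, hv, he⟩ := Ray.exists_prepend p hp s hs hps
  obtain ⟨R, h1, h2, h3⟩ := exists_doubleRay r s' (hr.trans hs0.symm) fun i j hij => by
    rcases hv j with h | ⟨m, h⟩
    · have hi := hpr i (hij ▸ h)
      rw [hi, hr, ← hs0] at hij
      exact (s'.injective hij).symm
    · exact absurd (hij.trans h) (hrs i m)
  refine ⟨R, h1, h2.trans hss, fun e hR => ?_⟩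
  rcases h3 e hR with h | h
  · exact Or.inr (Or.inl h)
  · obtain ⟨n, rfl⟩ := s'.mem_edgeSet_toSubgraph.mp h
    rcases he n with h | ⟨m, h⟩
    · exact Or.inl h
    · exact Or.inr (Or.inr (s.mem_edgeSet_toSubgraph.mpr ⟨m, h⟩))

/-- If `r` met `s` infinitely often, the common vertices would occur arbitrarily late on `s`, so `s`
would return to every set containing a tail of `r` and the edge-ends would agree. -/
theorem eventually_ne_of_edgeEnd_ne {r s : Ray G} (h : r.edgeEnd ≠ s.edgeEnd) :
    ∀ᶠ n in atTop, ∀ m, r.vert n ≠ s.vert m := by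
  by_contra hc
  refine h (edgeEnd_eq_of_forall_cut fun Z _ hr => ?_)
  obtain ⟨N, hN⟩ := eventually_atTop.mp hr
  have hf : ∃ᶠ n in atTop, ∃ m, r.vert n = s.vert m := by
    simpa [Filter.Frequently] using hc
  refine frequently_atTop.mpr fun M => ?_
  by_contra hM
  push Not at hM
  have hinf := Nat.frequently_atTop_iff_infinite.mp (hf.and_eventually (eventually_ge_atTop N))
  refine hinf (Set.Finite.subset ((Set.finite_lt_nat M).image s.vert |>.preimage
    r.injective.injOn) ?_)
  rintro n ⟨⟨m, hm⟩, hn⟩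
  refine ⟨m, ?_, hm.symm⟩
  by_contra hmM
  exact hM m (not_lt.mp hmM) (hm ▸ hN n hn)

/-- The cut is the union of the components of `G ∖ F` that belong to `A`. If an edge-end of `B` had
its tail there too, disjoint tails of two rays in one component could be joined to a double ray
avoiding `F`. -/
theorem exists_cut_of_edgeSeparates {A B : Set (EdgeEnd G)} (hAB : Disjoint A B)
    {F : Finset (Sym2 V)} (hF : EdgeSeparates F A B) :
    ∃ Z, (boundary G Z).Finite ∧ (∀ a ∈ A, a.LiesIn Z) ∧ (∀ b ∈ B, b.LiesIn Zᶜ) ∧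
      (boundary G Z).encard ≤ F.card := by
  have hfin : (F : Set (Sym2 V)).Finite := F.finite_toSet
  let Z : Set V := {v | ∃ a ∈ A, v ∈ EdgeEnd.component (F : Set (Sym2 V)) a}
  have hcut : cutEdges G Z ⊆ F := by
    rintro _ ⟨⟨u, v⟩, ⟨hadj, hu, a, ha, hv⟩, rfl⟩
    exact EdgeEnd.cutEdges_component_subset _ a
      (mem_cutEdges hadj (fun h => hu ⟨a, ha, h⟩) hv)
  have hZ : (boundary G Z).Finite := finite_boundary_of_cutEdges (hfin.subset hcut)
  refine ⟨Z, hZ, fun a ha => (EdgeEnd.liesIn_component hfin a).mono fun v hv => ⟨a, ha, hv⟩,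
    fun b hb => ?_, ?_⟩
  · rw [EdgeEnd.liesIn_compl hZ]
    intro hbZ
    obtain ⟨D, N, hN⟩ := b.rep.exists_hasTailIn hfin
    obtain ⟨n, ⟨a, ha, hna⟩, hn⟩ := (Eventually.and hbZ (eventually_ge_atTop N)).exists
    rw [← a.edgeEnd_rep, EdgeEnd.mem_component_edgeEnd_iff hfin hF.1] at hna
    obtain ⟨M, hM⟩ := hna
    have hne : a.rep.edgeEnd ≠ b.rep.edgeEnd := by
      rw [a.edgeEnd_rep, b.edgeEnd_rep]
      rintro rfl
      exact Set.disjoint_left.mp hAB ha hb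
    obtain ⟨K, hK⟩ := eventually_atTop.mp (eventually_ne_of_edgeEnd_ne hne)
    -- Past `M` the ray of `a` stays in the component, and past `K` it misses the ray of `b`; the
    -- latter avoids `F` from `n` on.
    let r := a.rep.drop (max M K)
    let s := b.rep.drop n
    have hrF : ∀ i, s(r.vert i, r.vert (i + 1)) ∉ (F : Set (Sym2 V)) := fun i =>
      (deleteEdges_adj.mp (hM (max M K + i) (by omega)).1).2
    have hsF : ∀ i, s(s.vert i, s.vert (i + 1)) ∉ (F : Set (Sym2 V)) := fun i =>
      (deleteEdges_adj.mp (hN (n + i) (by omega)).1).2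
    have hrs : ∀ i j, r.vert i ≠ s.vert j := fun i j => hK _ (by omega) _
    rcases exists_link_or_closed (G := G) (X := Set.range r.vert) (Y := Set.range s.vert)
      (fun u v => s(u, v) ∉ (F : Set (Sym2 V))) with ⟨P, hP⟩ | ⟨R, h1, h2, h3⟩
    · obtain ⟨i, hi⟩ := P.source_mem
      obtain ⟨j, hj⟩ := P.target_mem
      obtain ⟨Q, hQ1, hQ2, hQ3⟩ := exists_doubleRay_of_path P.walk P.isPath (r.drop i) (s.drop j)
        hi hj (fun m hm => by
          have := r.injective ((P.eq_source _ hm ⟨i + m, rfl⟩).trans hi.symm)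
          omega) (fun m hm => by
          have := s.injective ((P.eq_target _ hm ⟨j + m, rfl⟩).trans hj.symm)
          omega) fun i' j' => hrs _ _
      refine hF.2 ⟨Q.toSubgraph, ⟨a, ha, b, hb, Or.inr (Or.inr ⟨Q, 0, ?_, ?_, rfl⟩)⟩, ?_⟩
      · rw [hQ1, Ray.edgeEnd_drop, Ray.edgeEnd_drop, a.edgeEnd_rep]
      · rw [hQ2, Ray.edgeEnd_drop, Ray.edgeEnd_drop, b.edgeEnd_rep]
      · refine Set.disjoint_left.mpr fun e he => ?_
        rcases hQ3 e he with h | h | h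
        · obtain ⟨d, hd, rfl⟩ := List.mem_map.mp h
          exact hP d hd
        · obtain ⟨m, rfl⟩ := (Ray.mem_edgeSet_toSubgraph _).mp h
          exact hrF _
        · obtain ⟨m, rfl⟩ := (Ray.mem_edgeSet_toSubgraph _).mp h
          exact hsF _
    -- Without a link, the cut around `R` would part the two tails using edges of `F` only, although
    -- both lie in one component of `G ∖ F`.
    · have hR : cutEdges G R ⊆ F := by
        rintro _ ⟨⟨u, v⟩, ⟨hadj, hu, hv⟩, rfl⟩
        by_contra h
        exact h3 v hv u hu hadj.symm (Sym2.eq_swap (a := u) (b := v) ▸ h)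
      have hreach := (mem_iff_of_reachable_deleteEdges hR
        (ConnectedComponent.eq.mp (hM (max M K) (le_max_left _ _)).2)).mp (h1 ⟨0, rfl⟩)
      exact Set.disjoint_left.mp h2 hreach ⟨0, rfl⟩
  · rw [← encard_cutEdges, ← Set.encard_coe_eq_coe_finsetCard]
    exact Set.encard_le_encard hcut

theorem EdgeDominates.mem_iff {v : V} {ω : EdgeEnd G} (h : EdgeDominates v ω) {Z : Set V}
    (hZ : (boundary G Z).Finite) : v ∈ Z ↔ ω.LiesIn Z :=
  ⟨h.liesIn hZ, h.mem hZ⟩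

theorem IsVertexEndPath.mem_iff {v : V} {ω : EdgeEnd G} {P : G.Subgraph}
    (h : IsVertexEndPath v ω P) {Z : Set V} (hZ : (boundary G Z).Finite)
    (hP : Disjoint P.edgeSet (cutEdges G Z)) : v ∈ Z ↔ ω.LiesIn Z := by
  rcases h with ⟨r, rfl, rfl, rfl⟩ | ⟨w, hw, p, -, rfl⟩
  · have hall : ∀ n, r.vert 0 ∈ Z ↔ r.vert n ∈ Z := fun n => by
      induction n with
      | zero => rfl
      | succ n ih =>
        exact ih.trans (mem_iff_of_adj (r.adj n)
          (Set.disjoint_left.mp hP (r.mem_edgeSet_toSubgraph.mpr ⟨n, rfl⟩)))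
    rw [liesIn_edgeEnd_iff hZ]
    exact ⟨fun h => Eventually.of_forall fun n => (hall n).mp h,
      fun h => (hall _).mpr h.exists.choose_spec⟩
  · rw [← hw.mem_iff hZ]
    exact mem_iff_of_walk p fun e he =>
      Set.disjoint_left.mp hP (p.mem_edges_toSubgraph.mpr he)

/-- Following the path without crossing the cut keeps the side unchanged, also in the limit along a
ray and when passing from a dominating vertex to its edge-end. -/
theorem IsEndEndPath.liesIn_iff {a b : EdgeEnd G} {P : G.Subgraph}
    (h : IsEndEndPath a b P) {Z : Set V} (hZ : (boundary G Z).Finite)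
    (hP : Disjoint P.edgeSet (cutEdges G Z)) : a.LiesIn Z ↔ b.LiesIn Z := by
  rcases h with ⟨v, hv, h⟩ | ⟨v, hv, h⟩ | ⟨R, n, rfl, rfl, rfl⟩
  · exact (h.mem_iff hZ hP).symm.trans (hv.mem_iff hZ)
  · exact (hv.mem_iff hZ).symm.trans (h.mem_iff hZ hP)
  · have key : ∀ r : Ray G, r.vert 0 = R.vert n → r.toSubgraph.edgeSet ⊆ R.toSubgraph.edgeSet →
        (R.vert n ∈ Z ↔ r.edgeEnd.LiesIn Z) := fun r h0 hr =>
      IsVertexEndPath.mem_iff (Or.inl ⟨r, h0, rfl, rfl⟩) hZ (hP.mono_left hr)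
    refine (key _ (by simp [DoubleRay.backward]) ?_).symm.trans
      (key _ (by simp [DoubleRay.forward]) ?_)
    · intro e he
      obtain ⟨m, rfl⟩ := (Ray.mem_edgeSet_toSubgraph _).mp he
      refine R.mem_edgeSet_toSubgraph.mpr ⟨n - (m + 1 : ℕ), ?_⟩
      rw [Sym2.eq_swap]
      simp only [DoubleRay.backward]
      congr 3
      push_cast
      ring
    · intro e he
      obtain ⟨m, rfl⟩ := (Ray.mem_edgeSet_toSubgraph _).mp he
      refine R.mem_edgeSet_toSubgraph.mpr ⟨n + m, ?_⟩
      simp only [DoubleRay.forward]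
      push_cast
      rw [add_assoc]

theorem le_encard_boundary {A B : Set (EdgeEnd G)} {k : ℕ}
    (hmin : ∀ F : Finset (Sym2 V), EdgeSeparates F A B → k ≤ F.card) {Z : Set V}
    (hZ : (boundary G Z).Finite) (hA : ∀ a ∈ A, a.LiesIn Z) (hB : ∀ b ∈ B, b.LiesIn Zᶜ) :
    (k : ℕ∞) ≤ (boundary G Z).encard := by
  have hfin : (cutEdges G Z).Finite := hZ.image _
  have h := hmin hfin.toFinset ⟨by simpa using cutEdges_subset Z, ?_⟩
  · rw [← encard_cutEdges, hfin.encard_eq_coe_toFinset_card]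
    exact_mod_cast h
  · rintro ⟨P, ⟨a, ha, b, hb, hP⟩, hd⟩
    rw [Set.Finite.coe_toFinset] at hd
    exact ((hP.liesIn_iff hZ hd).mp (hA a ha)).not_compl (hB b hb)

/-- A minimum cut between `T` and `S` that is attained is already forced by finitely many
elements of `T`. -/
theorem exists_finite_subset_forcing {S T : Set (EdgeEnd G)} {k : ℕ}
    (hmin : ∀ W, (boundary G W).Finite → (∀ t ∈ T, t.LiesIn W) → (∀ s ∈ S, s.LiesIn Wᶜ) →
      (k : ℕ∞) ≤ (boundary G W).encard)
    {W₀ : Set V} (hT₀ : ∀ t ∈ T, t.LiesIn W₀)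
    (hS₀ : ∀ s ∈ S, s.LiesIn W₀ᶜ) (hle : (boundary G W₀).encard ≤ k) :
    ∃ T' ⊆ T, T'.Finite ∧ ∀ W, (boundary G W).Finite → (∀ t ∈ T', t.LiesIn W) →
      (∀ s ∈ S, s.LiesIn Wᶜ) → (k : ℕ∞) ≤ (boundary G W).encard := by
  have hfin₀ : (boundary G W₀).Finite := Set.finite_of_encard_le_coe hle
  by_contra! H
  -- A small cut may be shrunk into `W₀`: its union with `W₀` still separates `T` from `S`, hence
  -- has boundary at least `k`, and submodularity bounds the intersection.
  have H' : ∀ T' ⊆ T, T'.Finite → ∃ W ⊆ W₀, (boundary G W).Finite ∧ (∀ t ∈ T', t.LiesIn W) ∧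
      (boundary G W).encard < k := by
    intro T' hT' hfin
    obtain ⟨W, hW, hTW, hSW, hlt⟩ := H T' hT' hfin
    refine ⟨W ∩ W₀, Set.inter_subset_right, finite_boundary_inter hW hfin₀,
      fun t ht => (hTW t ht).inter (hT₀ t (hT' ht)), lt_of_le_of_lt ?_ hlt⟩
    have hun := hmin (W ∪ W₀) (finite_boundary_union hW hfin₀)
      (fun t ht => (hT₀ t ht).mono Set.subset_union_right)
      (fun s hs => by rw [Set.compl_union]; exact (hSW s hs).inter (hS₀ s hs))
    have hsub := encard_boundary_submodular (G := G) W W₀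
    have := (add_le_add_right hun _).trans (hsub.trans (add_le_add_right hle _))
    exact (ENat.add_le_add_iff_right (ENat.natCast_ne_top k)).mp this
  let p : ℕ → Prop := fun n => ∃ T' ⊆ T, T'.Finite ∧ ∀ W ⊆ W₀, (boundary G W).Finite →
    (∀ t ∈ T', t.LiesIn W) → (n : ℕ∞) ≤ (boundary G W).encard
  have hp : ∀ n, p n → n < k := by
    rintro n ⟨T', hT', hfin, h⟩
    obtain ⟨W, hW, hWf, hTW, hlt⟩ := H' T' hT' hfin
    exact_mod_cast (h W hW hWf hTW).trans_lt hlt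
  -- `m` is the largest cut size inside `W₀` that a finite part of `T` can force; by `hp` it is
  -- below `k`.
  obtain ⟨m, hm, hm'⟩ : ∃ m, p m ∧ ¬ p (m + 1) := by
    by_contra! hc
    have : ∀ n, p n := fun n => by
      induction n with
      | zero => exact ⟨∅, by simp, by simp, by simp⟩
      | succ n ih => exact hc n ih
    exact lt_irrefl k (hp k (this k))
  have hmk := hp m hm
  obtain ⟨T', hT', hfin, hlow⟩ := hm
  have hup : ∀ T'' ⊆ T, T''.Finite → ∃ W ⊆ W₀, (boundary G W).Finite ∧
      (∀ t ∈ T'', t.LiesIn W) ∧ (boundary G W).encard ≤ m := by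
    intro T'' hT'' hfin''
    by_contra! hc
    exact hm' ⟨T'', hT'', hfin'', fun W h1 h2 h3 => by
      simpa using Order.add_one_le_of_lt (hc W h1 h2 h3)⟩
  let 𝓜 : Set (Set V) := {W | W ⊆ W₀ ∧ (boundary G W).Finite ∧ (∀ t ∈ T', t.LiesIn W) ∧
    (boundary G W).encard ≤ m}
  -- The intersection still surrounds `T'`, so it has at least `m` boundary edges, leaving at most
  -- `m` for the union.
  have hunion : ∀ W₁ ∈ 𝓜, ∀ W₂ ∈ 𝓜, W₁ ∪ W₂ ∈ 𝓜 := by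
    rintro W₁ ⟨h1, f1, t1, e1⟩ W₂ ⟨h2, f2, t2, e2⟩
    refine ⟨Set.union_subset h1 h2, finite_boundary_union f1 f2,
      fun t ht => (t1 t ht).mono Set.subset_union_left, ?_⟩
    have hint := hlow (W₁ ∩ W₂) (Set.inter_subset_left.trans h1) (finite_boundary_inter f1 f2)
      fun t ht => (t1 t ht).inter (t2 t ht)
    have hsub := encard_boundary_submodular (G := G) W₁ W₂
    have := (add_le_add_left hint _).trans (hsub.trans (add_le_add e1 e2))
    exact (ENat.add_le_add_iff_left (ENat.natCast_ne_top m)).mp this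
  have hsubU : ∀ W ∈ 𝓜, W ⊆ ⋃₀ 𝓜 := fun W hW => Set.subset_sUnion_of_mem hW
  -- Any `m + 1` boundary edges of the big union would already be boundary edges of a finite union,
  -- which is a member of `𝓜`.
  have hbd : (boundary G (⋃₀ 𝓜)).encard ≤ m := by
    by_contra! hc
    obtain ⟨E, hE, hEm⟩ := Set.exists_subset_encard_eq (Order.add_one_le_of_lt hc)
    have hEfin : E.Finite := Set.finite_of_encard_eq_coe (k := m + 1) (by exact_mod_cast hEm)
    have : ∃ W ∈ 𝓜, ∀ e ∈ E, e.2 ∈ W := by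
      clear hEm
      induction E, hEfin using Set.Finite.induction_on with
      | empty =>
        obtain ⟨W, h⟩ := hup T' hT' hfin
        exact ⟨W, h, by simp⟩
      | insert _ _ ih =>
        obtain ⟨W, hW, hWE⟩ := ih ((Set.subset_insert _ _).trans hE)
        obtain ⟨W₁, hW₁, he⟩ := (hE (Set.mem_insert _ _)).2.2
        refine ⟨W₁ ∪ W, hunion _ hW₁ _ hW, fun e' he' => ?_⟩
        rcases he' with rfl | he'
        · exact Or.inl he
        · exact Or.inr (hWE e' he')
    obtain ⟨W, hW, hWE⟩ := this
    have hsub : E ⊆ boundary G W := fun e he =>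
      ⟨(hE he).1, fun h => (hE he).2.1 (hsubU W hW h), hWE e he⟩
    have := (Set.encard_le_encard hsub).trans hW.2.2.2
    rw [hEm] at this
    exact absurd this (by exact_mod_cast (Nat.lt_succ_self m).not_ge)
  have hU₀ : ⋃₀ 𝓜 ⊆ W₀ := Set.sUnion_subset fun W hW => hW.1
  -- Every `t ∈ T` lies in the union, because adding `t` to `T'` does not force size `m + 1`. This
  -- gives a cut around all of `T` of size at most `m < k`.
  have := hmin (⋃₀ 𝓜) (Set.finite_of_encard_le_coe hbd) (fun t ht => by
      obtain ⟨W, h1, h2, h3, h4⟩ := hup (insert t T') (Set.insert_subset ht hT') (hfin.insert t)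
      exact (h3 t (Set.mem_insert _ _)).mono (hsubU W ⟨h1, h2, fun t' ht' =>
        h3 t' (Set.mem_insert_of_mem _ ht'), h4⟩))
    fun s hs => (hS₀ s hs).mono (Set.compl_subset_compl.mpr hU₀)
  exact absurd (this.trans hbd) (by exact_mod_cast hmk.not_ge)

end Separation

/-! ### Extending the boundary edges of a tight cut to edge-disjoint rays -/

section RayExtension

variable {V : Type*} {G : SimpleGraph V}

/-- Paths running through consecutive layers of a decreasing sequence of sets concatenate to a
ray. -/
theorem exists_ray_of_layers {Z : ℕ → Set V} (hZ : Antitone Z) (q : ℕ → ℕ → V) (l : ℕ → ℕ)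
    (hl : ∀ n, 0 < l n) (hadj : ∀ n, ∀ i < l n, G.Adj (q n i) (q n (i + 1)))
    (hq : ∀ n, ∀ i < l n, q n i ∈ Z n ∧ q n i ∉ Z (n + 1))
    (hinj : ∀ n, ∀ i < l n, ∀ j < l n, q n i = q n j → i = j)
    (hnext : ∀ n, q n (l n) = q (n + 1) 0) :
    ∃ r : Ray G, r.vert 0 = q 0 0 ∧
      (∀ m, ∃ n, ∃ i < l n, r.vert m = q n i ∧ r.vert (m + 1) = q n (i + 1)) ∧
      ∀ n, ∃ m ≥ n, r.vert m = q n 0 := by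
  -- A position is a pair (layer, index within the layer), advanced in lexicographic order.
  -- Different layers `Z n \ Z (n + 1)` are disjoint, which gives injectivity.
  let next : ℕ × ℕ → ℕ × ℕ := fun a => if a.2 + 1 < l a.1 then (a.1, a.2 + 1) else (a.1 + 1, 0)
  let s : ℕ → ℕ × ℕ := fun m => next^[m] (0, 0)
  have hs : ∀ m, s (m + 1) = next (s m) := fun m => Function.iterate_succ_apply' _ _ _
  have hsl : ∀ m, (s m).2 < l (s m).1 := fun m => by
    induction m with
    | zero => exact hl 0
    | succ m ih =>
      rw [hs]
      simp only [next]
      split_ifs with h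
      · exact h
      · exact hl _
  have hstep : ∀ m, q (s (m + 1)).1 (s (m + 1)).2 = q (s m).1 ((s m).2 + 1) := fun m => by
    rw [hs]
    simp only [next]
    split_ifs with h
    · rfl
    · rw [← hnext, show l (s m).1 = (s m).2 + 1 from le_antisymm (not_lt.mp h) (hsl m)]
  have hmono : StrictMono fun m => toLex (s m) := strictMono_nat_of_lt_succ fun m => by
    rw [hs, Prod.Lex.toLex_lt_toLex]
    simp only [next]
    split_ifs with h
    · exact Or.inr ⟨rfl, Nat.lt_succ_self _⟩
    · exact Or.inl (Nat.lt_succ_self _)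
  have hlt : ∀ m m', m < m' → q (s m).1 (s m).2 ≠ q (s m').1 (s m').2 := by
    intro m m' hmm h
    have h1 := hq _ _ (hsl m)
    have h2 := hq _ _ (hsl m')
    rcases (Prod.Lex.toLex_lt_toLex).mp (hmono hmm) with h3 | ⟨h3, h4⟩
    · exact h1.2 (h ▸ hZ h3 h2.1)
    · rw [← h3] at h
      exact h4.ne (hinj _ _ (hsl m) _ (h3 ▸ hsl m') h)
  -- Each step advances at most one layer, so layer `n` is not entered before time `n`.
  have hle : ∀ m, (s m).1 ≤ m := fun m => by
    induction m with
    | zero => rfl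
    | succ m ih =>
      rw [hs]
      simp only [next]
      split_ifs with h
      · exact ih.trans (Nat.le_succ m)
      · exact Nat.succ_le_succ ih
  have hreach : ∀ n, ∃ m, s m = (n, 0) := fun n => by
    induction n with
    | zero => exact ⟨0, rfl⟩
    | succ n ih =>
      obtain ⟨m, hm⟩ := ih
      have : ∀ i < l n, s (m + i) = (n, i) := fun i => by
        induction i with
        | zero => exact fun _ => hm
        | succ i ih =>
          intro hi
          rw [← add_assoc, hs, ih (by omega)]
          simp [next, hi]
      refine ⟨m + (l n - 1) + 1, ?_⟩
      have hl := hl n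
      rw [hs, this _ (by omega)]
      simp only [next]
      rw [if_neg (by omega)]
  refine ⟨⟨fun m => q (s m).1 (s m).2, fun m m' h => ?_, fun m => ?_⟩, rfl,
    fun m => ⟨_, _, hsl m, rfl, hstep m⟩, fun n => ?_⟩
  · rcases lt_trichotomy m m' with h' | h' | h'
    · exact absurd h (hlt _ _ h')
    · exact h'
    · exact absurd h.symm (hlt _ _ h')
  · rw [hstep]
    exact hadj _ _ (hsl m)
  · obtain ⟨m, hm⟩ := hreach n
    have := hle m
    rw [hm] at this
    exact ⟨m, this, by simp only [hm]⟩

theorem exists_cut_not_mem {T : Set (EdgeEnd G)} (hT : T.Finite) {v : V}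
    (hv : ∀ t ∈ T, ¬ EdgeDominates v t) :
    ∃ W, (boundary G W).Finite ∧ (∀ t ∈ T, t.LiesIn W) ∧ v ∉ W := by
  induction T, hT using Set.Finite.induction_on with
  | empty => exact ⟨∅, by simp [boundary], by simp, by simp⟩
  | insert _ _ ih =>
    obtain ⟨W, hW, hTW, hvW⟩ := ih fun t ht => hv t (Set.mem_insert_of_mem _ ht)
    obtain ⟨W', hW', hTW', hvW'⟩ := exists_cut_of_not_edgeDominates (hv _ (Set.mem_insert _ _))
    refine ⟨W' ∪ W, finite_boundary_union hW' hW, fun t ht => ?_, fun h => h.elim hvW' hvW⟩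
    rcases ht with rfl | ht
    · exact hTW'.mono Set.subset_union_left
    · exact (hTW t ht).mono Set.subset_union_right

/-- Each vertex of `K` dominates no member of `T`, so it can be cut off separately, and finitely
many such cuts can be intersected. -/
theorem exists_cut_disjoint {T : Set (EdgeEnd G)} (hT : T.Finite)
    (hd : ∀ t ∈ T, ∀ v, ¬ EdgeDominates v t) {K : Set V} (hK : K.Finite) {Z : Set V}
    (hZ : (boundary G Z).Finite) (hTZ : ∀ t ∈ T, t.LiesIn Z) :
    ∃ W ⊆ Z, (boundary G W).Finite ∧ (∀ t ∈ T, t.LiesIn W) ∧ Disjoint W K := by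
  induction K, hK using Set.Finite.induction_on with
  | empty => exact ⟨Z, subset_rfl, hZ, hTZ, by simp⟩
  | @insert v _ _ _ ih =>
    obtain ⟨W, hWZ, hW, hTW, hWK⟩ := ih
    obtain ⟨W', hW', hTW', hv⟩ := exists_cut_not_mem hT fun t ht => hd t ht v
    refine ⟨W ∩ W', Set.inter_subset_left.trans hWZ, finite_boundary_inter hW hW',
      fun t ht => (hTW t ht).inter (hTW' t ht), ?_⟩
    rw [Set.disjoint_insert_right]
    exact ⟨fun h => hv h.2, hWK.mono_left Set.inter_subset_left⟩

/-- `Z` is a finite cut around `T` that is no larger than any smaller cut around `T`. -/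
structure IsTight (T : Set (EdgeEnd G)) (Z : Set V) : Prop where
  finite : (boundary G Z).Finite
  liesIn : ∀ t ∈ T, t.LiesIn Z
  le : ∀ W ⊆ Z, (boundary G W).Finite → (∀ t ∈ T, t.LiesIn W) →
    (boundary G Z).encard ≤ (boundary G W).encard

theorem exists_isTight {T : Set (EdgeEnd G)} {U : Set V} (hU : (boundary G U).Finite)
    (hTU : ∀ t ∈ T, t.LiesIn U) : ∃ Z ⊆ U, IsTight T Z := by
  obtain ⟨Z, ⟨hZU, hZ, hTZ⟩, hmin⟩ :=
    (InvImage.wf (fun W => (boundary G W).encard) wellFounded_lt).has_min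
      {W | W ⊆ U ∧ (boundary G W).Finite ∧ ∀ t ∈ T, t.LiesIn W} ⟨U, subset_rfl, hU, hTU⟩
  exact ⟨Z, hZU, hZ, hTZ, fun W hWZ hW hTW => not_lt.mp (hmin W ⟨hWZ.trans hZU, hW, hTW⟩)⟩

/-- Let `D` be the component of `G[Z]` at the head of `e`. Removing `D` from `Z` takes `e` out of
the boundary and adds no new edge. If the tails from `N` missed `D`, the result would be a smaller
cut around `T`, against tightness. -/
theorem IsTight.exists_walk {T : Set (EdgeEnd G)} {Z : Set V} (hZ : IsTight T Z) {e : V × V}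
    (he : e ∈ boundary G Z) (N : ℕ) :
    ∃ t ∈ T, ∃ j ≥ N, ∃ p : G.Walk e.2 (t.rep.vert j), ∀ v ∈ p.support, v ∈ Z := by
  let D : Set V := {v | ∃ p : G.Walk e.2 v, ∀ w ∈ p.support, w ∈ Z}
  have hsub : boundary G (Z \ D) ⊂ boundary G Z := by
    refine ⟨fun c hc => ⟨hc.1, fun h => ?_, hc.2.2.1⟩, fun h => ?_⟩
    · obtain ⟨p, hp⟩ : c.1 ∈ D := by
        by_contra h'
        exact hc.2.1 ⟨h, h'⟩
      refine hc.2.2.2 ⟨p.concat hc.1, fun w hw => ?_⟩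
      rw [Walk.support_concat, List.mem_append, List.mem_singleton] at hw
      rcases hw with hw | rfl
      · exact hp w hw
      · exact hc.2.2.1
    · exact (h he).2.2.2 ⟨Walk.nil, by simpa using he.2.2⟩
  have hfin := hZ.finite.subset hsub.subset
  by_contra! hc
  refine (hfin.encard_lt_encard hsub).not_ge (hZ.le _ Set.sdiff_subset hfin fun t ht => ?_)
  filter_upwards [hZ.liesIn t ht, eventually_ge_atTop N] with n hn hnN
  refine ⟨hn, fun ⟨p, hp⟩ => ?_⟩
  obtain ⟨v, hv, hvZ⟩ := hc t ht n hnN p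
  exact hvZ (hp v hv)

/-- `Z'` is a tight cut inside `Z`, and between them the edges of the boundary of `Z` are linked
to the tails from `N` of the rays of `T`. -/
structure IsStep (T : Set (EdgeEnd G)) (N : ℕ) (Z Z' : Set V) : Prop where
  subset : Z' ⊆ Z
  isTight : IsTight T Z'
  exists_walk : ∀ e ∈ boundary G Z, ∃ t ∈ T, ∃ j ≥ N, ∃ p : G.Walk e.2 (t.rep.vert j),
    ∀ v ∈ p.support, v ∈ Z ∧ v ∉ Z'

/-- There are finitely many boundary edges, so the walks to the rays use a finite vertex set; the
next cut is chosen tight inside a cut avoiding that set. -/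
theorem IsTight.exists_isStep {T : Set (EdgeEnd G)} (hT : T.Finite)
    (hd : ∀ t ∈ T, ∀ v, ¬ EdgeDominates v t) {Z : Set V} (hZ : IsTight T Z) (N : ℕ) :
    ∃ Z', IsStep T N Z Z' := by
  choose t ht j hj p hp using fun e (he : e ∈ boundary G Z) => hZ.exists_walk he N
  let K : Set V := ⋃ e : boundary G Z, {v | v ∈ (p e e.2).support}
  have hK : K.Finite := by
    have := hZ.finite.to_subtype
    exact Set.finite_iUnion fun e => List.finite_toSet _
  obtain ⟨W, hWZ, hW, hTW, hWK⟩ := exists_cut_disjoint hT hd hK hZ.finite hZ.liesIn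
  obtain ⟨Z', hZ'W, hZ'⟩ := exists_isTight hW hTW
  refine ⟨Z', hZ'W.trans hWZ, hZ', fun e he => ⟨t e he, ht e he, j e he, hj e he, p e he, fun v hv =>
    ⟨hp e he v hv, fun h => ?_⟩⟩⟩
  exact Set.disjoint_left.mp hWK (hZ'W h) (Set.mem_iUnion.mpr ⟨⟨e, he⟩, hv⟩)

theorem IsTight.exists_seq {T : Set (EdgeEnd G)} (hT : T.Finite)
    (hd : ∀ t ∈ T, ∀ v, ¬ EdgeDominates v t) {Z₀ : Set V} (hZ₀ : IsTight T Z₀) :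
    ∃ Z : ℕ → Set V, Z 0 = Z₀ ∧ (∀ n, IsTight T (Z n)) ∧ ∀ n, IsStep T n (Z n) (Z (n + 1)) := by
  choose f hf using fun (Z : {Z : Set V // IsTight T Z}) (n : ℕ) =>
    IsTight.exists_isStep hT hd Z.2 n
  let Z : ℕ → {Z : Set V // IsTight T Z} := fun n =>
    Nat.rec ⟨Z₀, hZ₀⟩ (fun n Z => ⟨f Z n, (hf Z n).isTight⟩) n
  exact ⟨fun n => (Z n).1, rfl, fun n => (Z n).2, fun n => hf (Z n) n⟩

/-- Between consecutive tight cuts there are edge-disjoint paths starting at all the edges of the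
larger one. -/
theorem IsStep.exists_paths {T : Set (EdgeEnd G)} {N : ℕ} {Z Z' : Set V} (hZ : IsTight T Z)
    (h : IsStep T N Z Z') :
    ∃ (q : V × V → ℕ → V) (l : V × V → ℕ),
      (∀ e ∈ boundary G Z, 0 < l e ∧ q e 0 = e.2 ∧
        (∀ i < l e, G.Adj (q e i) (q e (i + 1)) ∧ q e i ∈ Z ∧ q e i ∉ Z') ∧ q e (l e) ∈ Z' ∧
        ∀ i < l e, ∀ j < l e, q e i = q e j → i = j) ∧
      ∀ e ∈ boundary G Z, ∀ e' ∈ boundary G Z, e ≠ e' → ∀ i < l e, ∀ j < l e',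
        s(q e i, q e (i + 1)) ≠ s(q e' j, q e' (j + 1)) := by
  obtain ⟨k, hk⟩ : ∃ k : ℕ, (boundary G Z).encard = k :=
    ⟨_, hZ.finite.encard_eq_coe_toFinset_card⟩
  -- A set separating `Zᶜ` from `Z'` has a complement inside `Z` that still surrounds `T`, so
  -- tightness supplies the Menger condition.
  obtain ⟨P, hP⟩ := exists_edgeDisjoint_links (G := G) (X := Zᶜ) (Y := Z') k fun W hXW hWY => by
    by_cases hW : (boundary G W).Finite
    · rw [← hk, ← encard_boundary_compl W]
      refine hZ.le _ (Set.compl_subset_comm.mp hXW) (finite_boundary_compl hW) fun t ht => ?_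
      exact (h.isTight.liesIn t ht).mono (Set.subset_compl_iff_disjoint_left.mpr hWY)
    · rw [Set.encard_eq_top_iff.mpr hW]
      exact le_top
  have hlen : ∀ i, 0 < (P i).walk.length := fun i => by
    rw [Nat.pos_iff_ne_zero]
    intro h0
    exact (P i).source_mem (h.subset (Walk.eq_of_length_eq_zero h0 ▸ (P i).target_mem))
  have hX : ∀ i j, j ≤ (P i).walk.length → (P i).walk.getVert j ∉ Z → j = 0 := fun i j hj hjZ =>
    (P i).isPath.getVert_injOn hj (Nat.zero_le _) <| by
      rw [Walk.getVert_zero]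
      exact (P i).eq_source _ (Walk.getVert_mem_support _ _) hjZ
  have hY : ∀ i j, j ≤ (P i).walk.length → (P i).walk.getVert j ∈ Z' → j = (P i).walk.length :=
    fun i j hj hjZ => (P i).isPath.getVert_injOn hj (Set.mem_ofPred_eq ▸ le_rfl) <| by
      rw [Walk.getVert_length]
      exact (P i).eq_target _ (Walk.getVert_mem_support _ _) hjZ
  have hedge : ∀ i j, j < (P i).walk.length →
      s((P i).walk.getVert j, (P i).walk.getVert (j + 1)) ∈ (P i).walk.edges := fun i j hj => by
    rw [← Walk.mem_edges_toSubgraph, Subgraph.mem_edgeSet]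
    exact (P i).walk.toSubgraph_adj_getVert hj
  -- The first edge of each link crosses the boundary of `Z`. There are as many links as boundary
  -- edges, so every boundary edge starts exactly one link.
  let g : Fin k → V × V := fun i => ((P i).walk.getVert 0, (P i).walk.getVert 1)
  have hg : ∀ i, g i ∈ boundary G Z := fun i => by
    refine ⟨(P i).walk.adj_getVert_succ (hlen i), ?_, ?_⟩
    · simpa [g] using (P i).source_mem
    · by_contra h1
      exact absurd (hX i 1 (hlen i) h1) one_ne_zero
  have hginj : Function.Injective g := fun i j hij => by
    by_contra hne
    refine hP i j hne _ (hedge i 0 (hlen i)) ?_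
    have : s((g i).1, (g i).2) = s((g j).1, (g j).2) := by rw [hij]
    exact this ▸ hedge j 0 (hlen j)
  have hgr : Set.range g = boundary G Z :=
    (Set.finite_range g).eq_of_subset_of_encard_le (Set.range_subset_iff.mpr hg) (by
      rw [hk]
      simpa using hginj.encard_range)
  rcases (boundary G Z).eq_empty_or_nonempty with hemp | ⟨e₀, he₀⟩
  · exact ⟨fun e _ => e.1, fun _ => 0, by simp [hemp], by simp [hemp]⟩
  obtain ⟨i₀, -⟩ : e₀ ∈ Set.range g := hgr ▸ he₀
  have : Nonempty (Fin k) := ⟨i₀⟩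
  choose! c hc using fun e (he : e ∈ boundary G Z) => (hgr ▸ he : e ∈ Set.range g)
  -- The walk provided by `IsStep` starts at the head of `e` outside `Z'`, so a link cannot end
  -- after its first edge.
  have hlen2 : ∀ e ∈ boundary G Z, 1 < (P (c e)).walk.length := fun e he => by
    refine lt_of_le_of_ne (hlen _) fun h1 => ?_
    obtain ⟨t, -, j, -, p, hp⟩ := h.exists_walk e he
    refine (hp e.2 p.start_mem_support).2 ?_
    rw [← hc e he]
    simp only [g]
    rw [h1, Walk.getVert_length]
    exact (P (c e)).target_mem
  -- The first edge is dropped, as it is `e` itself and belongs to the preceding layer; hence the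
  -- shift by one.
  refine ⟨fun e i => (P (c e)).walk.getVert (i + 1), fun e => (P (c e)).walk.length - 1,
    fun e he => ?_, fun e he e' he' hne => ?_⟩
  · beta_reduce
    have hl := hlen2 e he
    have hend : (P (c e)).walk.length - 1 + 1 = (P (c e)).walk.length := by omega
    refine ⟨by omega, congrArg Prod.snd (hc e he), fun i hi =>
      ⟨(P (c e)).walk.adj_getVert_succ (by omega), ?_, fun hi' => ?_⟩, ?_, fun i hi j hj hij => ?_⟩
    · by_contra hi'
      have := hX _ _ (by omega) hi'
      omega
    · have := hY _ _ (by omega) hi'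
      omega
    · rw [hend, Walk.getVert_length]
      exact (P (c e)).target_mem
    · have := (P (c e)).isPath.getVert_injOn (show i + 1 ≤ _ by omega)
        (show j + 1 ≤ _ by omega) hij
      omega
  · beta_reduce
    intro i hi j hj hij
    refine hP (c e) (c e') (fun hcc => hne ?_) _ (hedge _ (i + 1) (by omega))
      (hij ▸ hedge _ (j + 1) (by omega))
    rw [← hc e he, ← hc e' he', hcc]

/-- A ray that meets infinitely many layers in vertices linked inside the layer to the rays of a
finite set `T` of edge-ends has its edge-end in `T`. -/
theorem edgeEnd_mem_of_walks {T : Set (EdgeEnd G)} (hT : T.Finite) {Z : ℕ → Set V}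
    (hZ : Antitone Z) (r : Ray G)
    (h : ∀ n, ∃ m ≥ n, ∃ t ∈ T, ∃ j ≥ n, ∃ p : G.Walk (r.vert m) (t.rep.vert j),
      ∀ v ∈ p.support, v ∈ Z n ∧ v ∉ Z (n + 1)) : r.edgeEnd ∈ T := by
  -- Pigeonhole: a single `t` of the finite set `T` serves infinitely many layers.
  obtain ⟨t, ht, hfr⟩ : ∃ t ∈ T, ∃ᶠ n in atTop, ∃ m ≥ n, ∃ j ≥ n,
      ∃ p : G.Walk (r.vert m) (t.rep.vert j), ∀ v ∈ p.support, v ∈ Z n ∧ v ∉ Z (n + 1) := by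
    by_contra hc
    have := (eventually_all_finite hT).mpr fun t ht =>
      not_frequently.mp fun hfr => hc ⟨t, ht, hfr⟩
    obtain ⟨n, hn⟩ := this.exists
    obtain ⟨m, hm, t, ht, j, hj, hp⟩ := h n
    exact hn t ht ⟨m, hm, j, hj, hp⟩
  have : t.rep.edgeEnd = r.edgeEnd := edgeEnd_eq_of_forall_cut fun W hW htW => by
    obtain ⟨N, hN⟩ := eventually_atTop.mp htW
    -- The outer endpoint of each boundary edge of `W` lies in at most one layer, so walks within
    -- late layers do not cross the finite cut `W`.
    have hlayer : ∀ᶠ n in atTop, ∀ c ∈ boundary G W, ¬ (c.1 ∈ Z n ∧ c.1 ∉ Z (n + 1)) := by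
      refine (eventually_all_finite hW).mpr fun c _ => ?_
      by_cases hc : ∃ n, c.1 ∈ Z n ∧ c.1 ∉ Z (n + 1)
      · obtain ⟨n, -, hn⟩ := hc
        filter_upwards [eventually_ge_atTop (n + 1)] with m hm h'
        exact hn (hZ hm h'.1)
      · exact Eventually.of_forall fun n hn => hc ⟨n, hn⟩
    refine frequently_atTop.mpr fun M => ?_
    obtain ⟨n, ⟨m, hm, j, hj, p, hp⟩, hn, hnM, hnN⟩ := (hfr.and_eventually (hlayer.and
      ((eventually_ge_atTop M).and (eventually_ge_atTop N)))).exists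
    refine ⟨m, le_trans hnM hm, (mem_iff_of_walk p ?_).mpr (hN j (le_trans hnN hj))⟩
    rintro _ he ⟨c, hc, rfl⟩
    exact hn c hc (hp _ (p.fst_mem_support_of_mem_edges he))
  rw [← this, t.edgeEnd_rep]
  exact ht

/-- A tight cut around finitely many undominated edge-ends: all the edges of its boundary extend
to edge-disjoint rays inside the cut. -/
theorem IsTight.exists_rays {T : Set (EdgeEnd G)} (hT : T.Finite)
    (hd : ∀ t ∈ T, ∀ v, ¬ EdgeDominates v t) {Z₀ : Set V} (hZ₀ : IsTight T Z₀) :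
    ∃ r : boundary G Z₀ → Ray G, (∀ e, (r e).vert 0 = e.1.2) ∧ (∀ e n, (r e).vert n ∈ Z₀) ∧
      (∀ e, (r e).edgeEnd ∈ T) ∧
      ∀ e e', e ≠ e' → Disjoint (r e).toSubgraph.edgeSet (r e').toSubgraph.edgeSet := by
  obtain ⟨Z, rfl, htight, hstep⟩ := hZ₀.exists_seq hT hd
  have hanti : Antitone Z := antitone_nat_of_succ_le fun n => (hstep n).subset
  choose q l hq hdisj using fun n => (hstep n).exists_paths (htight n)
  -- `E e n` is the edge by which the ray begun at `e` enters `Z n`, namely the last edge of its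
  -- path through the preceding layer.
  let E : boundary G (Z 0) → ℕ → V × V := fun e n =>
    Nat.rec e.1 (fun n c => (q n c (l n c - 1), q n c (l n c))) n
  have hE : ∀ e n, E e n ∈ boundary G (Z n) := fun e n => by
    induction n with
    | zero => exact e.2
    | succ n ih =>
      obtain ⟨h1, -, h2, h3, -⟩ := hq n _ ih
      have h4 := h2 (l n (E e n) - 1) (by omega)
      rw [Nat.sub_add_cancel h1] at h4
      exact ⟨h4.1, h4.2.2, h3⟩
  have hEinj : ∀ e e', e ≠ e' → ∀ n, E e n ≠ E e' n := fun e e' hne n => by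
    induction n with
    | zero => exact fun h => hne (Subtype.ext h)
    | succ n ih =>
      intro h
      have h1 := (hq n _ (hE e n)).1
      have h2 := (hq n _ (hE e' n)).1
      refine hdisj n _ (hE e n) _ (hE e' n) ih (l n (E e n) - 1) (by omega)
        (l n (E e' n) - 1) (by omega) ?_
      rw [Nat.sub_add_cancel h1, Nat.sub_add_cancel h2]
      exact congrArg (fun c : V × V => s(c.1, c.2)) h
  choose r hr0 hr hrn using fun e => exists_ray_of_layers (G := G) hanti (fun n => q n (E e n))
    (fun n => l n (E e n)) (fun n => (hq n _ (hE e n)).1)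
    (fun n i hi => ((hq n _ (hE e n)).2.2.1 i hi).1)
    (fun n i hi => ((hq n _ (hE e n)).2.2.1 i hi).2) (fun n => (hq n _ (hE e n)).2.2.2.2)
    (fun n => (hq (n + 1) _ (hE e (n + 1))).2.1.symm)
  have hin : ∀ e n i, i < l n (E e n) → q n (E e n) (i + 1) ∈ Z n := fun e n i hi => by
    rcases Nat.lt_or_ge (i + 1) (l n (E e n)) with h | h
    · exact ((hq n _ (hE e n)).2.2.1 _ h).2.1
    · rw [show i + 1 = l n (E e n) by omega]
      exact (hstep n).subset (hq n _ (hE e n)).2.2.2.1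
  -- An edge of the earlier layer starts outside `Z (n + 1)`, whereas both endpoints of an edge of
  -- the later layer lie in `Z n'`.
  have hne : ∀ e e' n n' i i', i < l n (E e n) → i' < l n' (E e' n') → n < n' →
      s(q n (E e n) i, q n (E e n) (i + 1)) ≠ s(q n' (E e' n') i', q n' (E e' n') (i' + 1)) := by
    intro e e' n n' i i' hi hi' hn h
    refine ((hq n _ (hE e n)).2.2.1 i hi).2.2 (hanti hn ?_)
    rcases Sym2.eq_iff.mp h with ⟨h, -⟩ | ⟨h, -⟩
    · exact h ▸ ((hq n' _ (hE e' n')).2.2.1 i' hi').2.1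
    · exact h ▸ hin e' n' i' hi'
  refine ⟨r, fun e => (hr0 e).trans (hq 0 _ (hE e 0)).2.1, fun e m => ?_, fun e => ?_,
    fun e e' hee => Set.disjoint_left.mpr fun c hc hc' => ?_⟩
  · obtain ⟨n, i, hi, h, -⟩ := hr e m
    rw [h]
    exact hanti (Nat.zero_le n) ((hq n _ (hE e n)).2.2.1 i hi).2.1
  · refine edgeEnd_mem_of_walks hT hanti (r e) fun n => ?_
    obtain ⟨m, hm, hmn⟩ := hrn e n
    refine ⟨m, hm, ?_⟩
    rw [hmn, (hq n _ (hE e n)).2.1]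
    exact (hstep n).exists_walk _ (hE e n)
  · obtain ⟨m, rfl⟩ := (Ray.mem_edgeSet_toSubgraph _).mp hc
    obtain ⟨m', hm'⟩ := (Ray.mem_edgeSet_toSubgraph _).mp hc'
    obtain ⟨n, i, hi, h1, h2⟩ := hr e m
    obtain ⟨n', i', hi', h1', h2'⟩ := hr e' m'
    rw [h1, h2, h1', h2'] at hm'
    rcases lt_trichotomy n n' with h | rfl | h
    · exact hne e e' n n' i i' hi hi' h hm'
    · exact hdisj n _ (hE e n) _ (hE e' n) (hEinj e e' hee n) i hi i' hi' hm'
    · exact hne e' e n' n i' i hi' hi h hm'.symm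

end RayExtension

/-! ### Hubs and the construction of the paths -/

section Assembly

variable {V : Type*} {G : SimpleGraph V}

/-- The same path traversed backwards. -/
def Link.reverse {X Y : Set V} (P : Link G X Y) : Link G Y X where
  source := P.target
  target := P.source
  walk := P.walk.reverse
  isPath := P.isPath.reverse
  source_mem := P.target_mem
  target_mem := P.source_mem
  eq_source v hv := P.eq_target v (by simpa using hv)
  eq_target v hv := P.eq_source v (by simpa using hv)

theorem Link.exists_first_edge {X Y : Set V} (hXY : Disjoint X Y) (P : Link G X Y) :
    ∃ u, G.Adj u P.source ∧ u ∉ X ∧ s(u, P.source) ∈ P.walk.edges := by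
  have hlen : 0 < P.walk.length := by
    rw [Nat.pos_iff_ne_zero]
    intro h0
    exact Set.disjoint_left.mp hXY P.source_mem (Walk.eq_of_length_eq_zero h0 ▸ P.target_mem)
  have hadj : G.Adj P.source (P.walk.getVert 1) := by
    simpa using P.walk.adj_getVert_succ hlen
  refine ⟨P.walk.getVert 1, hadj.symm,
    fun h => hadj.ne (P.eq_source _ (P.walk.getVert_mem_support 1) h).symm, ?_⟩
  rw [Sym2.eq_swap, ← Walk.mem_edges_toSubgraph, Subgraph.mem_edgeSet]
  simpa using P.walk.toSubgraph_adj_getVert hlen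

theorem Link.not_subset_of_mem_edges {X Y : Set V} (P : Link G X Y) {e : Sym2 V}
    (he : e ∈ P.walk.edges) (h : ∀ v ∈ e, v ∈ X) : False := by
  induction e with | _ x y =>
  have hx := P.eq_source x (P.walk.fst_mem_support_of_mem_edges he) (h x (by simp))
  have hy := P.eq_source y (P.walk.snd_mem_support_of_mem_edges he) (h y (by simp))
  exact (P.walk.adj_of_mem_edges he).ne (hx.trans hy.symm)

theorem Ray.forall_mem_of_mem_edgeSet {r : Ray G} {Z : Set V} (h : ∀ n, r.vert n ∈ Z)
    {e : Sym2 V} (he : e ∈ r.toSubgraph.edgeSet) : ∀ v ∈ e, v ∈ Z := by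
  obtain ⟨n, rfl⟩ := r.mem_edgeSet_toSubgraph.mp he
  intro v hv
  rcases Sym2.mem_iff.mp hv with rfl | rfl <;> exact h _

/-- A set `D` of vertices dominating edge-ends of `T` and a set `Z` all of whose boundary edges
extend inside `Z` to edge-disjoint rays of edge-ends of `T`. -/
structure Hub (G : SimpleGraph V) (T : Set (EdgeEnd G)) where
  D : Set V
  Z : Set V
  dominates : ∀ v ∈ D, ∃ t ∈ T, EdgeDominates v t
  ray : boundary G Z → Ray G
  ray_zero : ∀ e, (ray e).vert 0 = e.1.2
  ray_mem : ∀ e n, (ray e).vert n ∈ Z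
  edgeEnd_mem : ∀ e, (ray e).edgeEnd ∈ T
  disjoint : ∀ e e', e ≠ e' → Disjoint (ray e).toSubgraph.edgeSet (ray e').toSubgraph.edgeSet

/-- The vertices of a hub. -/
def Hub.verts {T : Set (EdgeEnd G)} (H : Hub G T) : Set V := H.D ∪ H.Z

/-- A dominated edge-end follows its dominating vertex to the same side of every finite cut, and an
undominated one has a tail in the tight set `Z`. A cut containing the hub therefore contains all of
`T`. -/
theorem exists_hub {T : Set (EdgeEnd G)} (hT : T.Finite) {U : Set V}
    (hU : (boundary G U).Finite) (hTU : ∀ t ∈ T, t.LiesIn U) :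
    ∃ H : Hub G T, H.verts ⊆ U ∧
      ∀ W, (boundary G W).Finite → H.verts ⊆ W → ∀ t ∈ T, t.LiesIn W := by
  have hT' : {t ∈ T | ∀ v, ¬ EdgeDominates v t}.Finite := hT.subset (Set.sep_subset _ _)
  obtain ⟨Z, hZU, hZ⟩ := exists_isTight hU fun t (ht : t ∈ {t ∈ T | ∀ v, ¬ EdgeDominates v t}) =>
    hTU t ht.1
  obtain ⟨r, h0, hrZ, hrT, hdisj⟩ := hZ.exists_rays hT' fun t ht => ht.2
  refine ⟨⟨{v | ∃ t ∈ T, EdgeDominates v t}, Z, fun v hv => hv, r, h0, hrZ,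
    fun e => (hrT e).1, hdisj⟩, Set.union_subset ?_ hZU, fun W hW hHW t ht => ?_⟩
  · rintro v ⟨t, ht, hv⟩
    exact hv.mem hU (hTU t ht)
  · by_cases h : ∃ v, EdgeDominates v t
    · obtain ⟨v, hv⟩ := h
      exact hv.liesIn hW (hHW (Or.inl ⟨t, ht, hv⟩))
    · exact (hZ.liesIn t ⟨ht, not_exists.mp h⟩).mono (Set.subset_union_right.trans hHW)

/-- An edge of a ray of the hub `H` that starts with an edge in `L`. -/
def Hub.IsTailEdge {T : Set (EdgeEnd G)} (H : Hub G T) (L : List (Sym2 V)) (e : Sym2 V) : Prop :=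
  ∃ c : boundary G H.Z, s(c.1.1, c.1.2) ∈ L ∧ e ∈ (H.ray c).toSubgraph.edgeSet

theorem Hub.IsTailEdge.forall_mem {T : Set (EdgeEnd G)} {H : Hub G T} {L : List (Sym2 V)}
    {e : Sym2 V} (h : H.IsTailEdge L e) : ∀ v ∈ e, v ∈ H.verts := by
  obtain ⟨c, -, hc⟩ := h
  exact fun v hv => Or.inr (Ray.forall_mem_of_mem_edgeSet (H.ray_mem c) hc v hv)

theorem Hub.IsTailEdge.not_of_disjoint {T : Set (EdgeEnd G)} {H : Hub G T} {L L' : List (Sym2 V)}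
    (hL : ∀ e ∈ L, e ∉ L') {e : Sym2 V} (h : H.IsTailEdge L e) : ¬ H.IsTailEdge L' e := by
  obtain ⟨c, hc, he⟩ := h
  rintro ⟨c', hc', he'⟩
  refine Set.disjoint_left.mp (H.disjoint c c' ?_) he he'
  rintro rfl
  exact hL _ hc hc'

/-- The source of a link from a hub dominates an edge-end, or a ray of the hub ends there. -/
theorem Hub.source_cases {T : Set (EdgeEnd G)} (H : Hub G T) {Y : Set V}
    (hY : Disjoint H.verts Y) (P : Link G H.verts Y) :
    (∃ t ∈ T, EdgeDominates P.source t) ∨ ∃ r : Ray G, r.vert 0 = P.source ∧ r.edgeEnd ∈ T ∧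
      (∀ n, r.vert n ∈ H.verts) ∧ (∀ n, r.vert n ∈ P.walk.support → n = 0) ∧
      ∀ e ∈ r.toSubgraph.edgeSet, H.IsTailEdge P.walk.edges e := by
  rcases P.source_mem with h | h
  · exact Or.inl (H.dominates _ h)
  · obtain ⟨u, hadj, hu, he⟩ := P.exists_first_edge hY
    let c : boundary G H.Z := ⟨(u, P.source), hadj, fun h => hu (Or.inr h), h⟩
    refine Or.inr ⟨H.ray c, H.ray_zero c, H.edgeEnd_mem c, fun n => Or.inr (H.ray_mem c n),
      fun n hn => (H.ray c).injective ?_, fun e' he' => ⟨c, he, he'⟩⟩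
    rw [P.eq_source _ hn (Or.inr (H.ray_mem c n)), H.ray_zero c]

/-- Each endpoint of the link either dominates an edge-end or continues into a ray of its hub. The
four combinations give a finite path, two kinds of rays and a double ray. The description of the
edges is what later yields disjointness. -/
theorem exists_isPathBetween {A B : Set (EdgeEnd G)} (HA : Hub G A) (HB : Hub G B)
    (hd : Disjoint HA.verts HB.verts) (P : Link G HA.verts HB.verts) :
    ∃ Q : G.Subgraph, IsPathBetween A B Q ∧ ∀ e ∈ Q.edgeSet, e ∈ P.walk.edges ∨
      HA.IsTailEdge P.walk.edges e ∨ HB.IsTailEdge P.walk.edges e := by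
  have hB := HB.source_cases hd.symm P.reverse
  simp only [Link.reverse, Walk.edges_reverse, Walk.support_reverse, List.mem_reverse] at hB
  have hrev : ∀ e, HB.IsTailEdge P.walk.edges.reverse e → HB.IsTailEdge P.walk.edges e :=
    fun e ⟨c, h1, h2⟩ => ⟨c, by simpa using h1, h2⟩
  rcases HA.source_cases hd P with ⟨a, ha, hav⟩ | ⟨r, hr0, hra, hrv, hrP, hre⟩ <;>
    rcases hB with ⟨b, hb, hbv⟩ | ⟨s, hs0, hsb, hsv, hsP, hse⟩
  · exact ⟨P.walk.toSubgraph, ⟨a, ha, b, hb, Or.inr (Or.inl ⟨P.source, hav, Or.inr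
      ⟨P.target, hbv, P.walk, P.isPath, rfl⟩⟩)⟩, fun e he => Or.inl (by simpa using he)⟩
  · obtain ⟨s', h0, hs', -, he⟩ := Ray.exists_prepend P.walk P.isPath s hs0 hsP
    refine ⟨s'.toSubgraph, ⟨a, ha, _, hsb, Or.inr (Or.inl ⟨P.source, hav, Or.inl
      ⟨s', h0, hs', rfl⟩⟩)⟩, fun e hes => ?_⟩
    obtain ⟨n, rfl⟩ := s'.mem_edgeSet_toSubgraph.mp hes
    rcases he n with h | h
    · exact Or.inl h
    · exact Or.inr (Or.inr (hrev _ (hse _ (s.mem_edgeSet_toSubgraph.mpr h))))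
  · obtain ⟨r', h0, hr', -, he⟩ := Ray.exists_prepend P.walk.reverse P.isPath.reverse r hr0
      fun n hn => hrP n (by simpa using hn)
    refine ⟨r'.toSubgraph, ⟨_, hra, b, hb, Or.inl ⟨P.target, hbv, Or.inl
      ⟨r', h0, hr', rfl⟩⟩⟩, fun e hes => ?_⟩
    obtain ⟨n, rfl⟩ := r'.mem_edgeSet_toSubgraph.mp hes
    rcases he n with h | h
    · exact Or.inl (by simpa using h)
    · exact Or.inr (Or.inl (hre _ (r.mem_edgeSet_toSubgraph.mpr h)))
  · obtain ⟨R, hR1, hR2, he⟩ := exists_doubleRay_of_path P.walk P.isPath r s hr0 hs0 hrP hsP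
      fun i j h => Set.disjoint_left.mp hd (hrv i) (h ▸ hsv j)
    refine ⟨R.toSubgraph, ⟨_, hra, _, hsb, Or.inr (Or.inr ⟨R, 0, hR1, hR2, rfl⟩)⟩,
      fun e hes => (he e hes).imp_right ?_⟩
    exact Or.imp (hre e) fun h => hrev _ (hse e h)

theorem exists_edgeDisjoint_paths {A B : Set (EdgeEnd G)} (hA : A.Finite) (hB : B.Finite)
    {k : ℕ} {Z : Set V} (hZ : (boundary G Z).Finite) (hAZ : ∀ a ∈ A, a.LiesIn Z)
    (hBZ : ∀ b ∈ B, b.LiesIn Zᶜ)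
    (hmin : ∀ W, (boundary G W).Finite → (∀ a ∈ A, a.LiesIn W) → (∀ b ∈ B, b.LiesIn Wᶜ) →
      (k : ℕ∞) ≤ (boundary G W).encard) :
    ∃ Q : Fin k → G.Subgraph, (∀ i, IsPathBetween A B (Q i)) ∧
      ∀ i j, i ≠ j → Disjoint (Q i).edgeSet (Q j).edgeSet := by
  obtain ⟨HA, hHA, hA'⟩ := exists_hub hA hZ hAZ
  obtain ⟨HB, hHB, hB'⟩ := exists_hub hB (finite_boundary_compl hZ) hBZ
  have hd : Disjoint HA.verts HB.verts :=
    (Set.disjoint_compl_right_iff_subset.mpr subset_rfl).mono hHA hHB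
  obtain ⟨P, hP⟩ := exists_edgeDisjoint_links (G := G) (X := HA.verts) (Y := HB.verts) k
    fun W hAW hWB => by
      by_cases hW : (boundary G W).Finite
      · exact hmin W hW (hA' W hW hAW) (hB' Wᶜ (finite_boundary_compl hW)
          (Set.subset_compl_iff_disjoint_left.mpr hWB))
      · rw [Set.encard_eq_top_iff.mpr hW]
        exact le_top
  choose Q hQ hQe using fun i => exists_isPathBetween HA HB hd (P i)
  -- Link edges and ray edges never coincide: a link edge has an endpoint outside each hub, while a
  -- ray edge lies within one of the two disjoint hubs.
  have hPA : ∀ i L e, e ∈ (P i).walk.edges → ¬ HA.IsTailEdge L e := fun i L e he h =>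
    (P i).not_subset_of_mem_edges he h.forall_mem
  have hPB : ∀ i L e, e ∈ (P i).walk.edges → ¬ HB.IsTailEdge L e := fun i L e he h =>
    (P i).reverse.not_subset_of_mem_edges (by simpa [Link.reverse] using he) h.forall_mem
  have hAB : ∀ L L' e, HA.IsTailEdge L e → ¬ HB.IsTailEdge L' e := fun L L' e h h' => by
    induction e with | _ x y =>
    exact Set.disjoint_left.mp hd (h.forall_mem x (by simp)) (h'.forall_mem x (by simp))
  refine ⟨Q, hQ, fun i j hij => Set.disjoint_left.mpr fun e hi hj => ?_⟩
  rcases hQe i e hi with h | h | h <;> rcases hQe j e hj with h' | h' | h'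
  · exact hP i j hij e h h'
  · exact hPA i _ e h h'
  · exact hPB i _ e h h'
  · exact hPA j _ e h' h
  · exact h.not_of_disjoint (hP i j hij) h'
  · exact hAB _ _ e h h'
  · exact hPB j _ e h' h
  · exact hAB _ _ e h' h
  · exact h.not_of_disjoint (hP i j hij) h'

end Assembly

end EdgeEnds

/-! ### The main theorem -/

theorem mainTheorem3 {V : Type*} (G : SimpleGraph V) (A B : Set (EdgeEnds.EdgeEnd G))
    (hAB : Disjoint A B) (F : Finset (Sym2 V)) (hF : EdgeEnds.EdgeSeparates F A B)
    (hmin : ∀ F' : Finset (Sym2 V), EdgeEnds.EdgeSeparates F' A B → F.card ≤ F'.card) :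
    ∃ Ps : Set G.Subgraph, Ps.encard = F.card ∧
      (∀ P ∈ Ps, EdgeEnds.IsPathBetween A B P) ∧
      Ps.Pairwise fun P Q => Disjoint P.edgeSet Q.edgeSet := by
  obtain ⟨Z, hZ, hAZ, hBZ, hle⟩ := EdgeEnds.exists_cut_of_edgeSeparates hAB hF
  -- `B` is reduced first, against all of `A`, using complements of cuts. Then `A` is reduced
  -- against `B'`, so that the two finite sets together still force `F.card`.
  obtain ⟨B', hB', hBfin, hBmin⟩ := EdgeEnds.exists_finite_subset_forcing (S := A) (T := B)
    (k := F.card) (fun W hW hBW hAW => by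
      rw [← EdgeEnds.encard_boundary_compl]
      exact EdgeEnds.le_encard_boundary hmin (EdgeEnds.finite_boundary_compl hW) hAW
        (by simpa using hBW)) (W₀ := Zᶜ) hBZ (by simpa using hAZ)
    (by rwa [EdgeEnds.encard_boundary_compl])
  obtain ⟨A', hA', hAfin, hAmin⟩ := EdgeEnds.exists_finite_subset_forcing (S := B') (T := A)
    (k := F.card) (fun W hW hAW hBW => by
      rw [← EdgeEnds.encard_boundary_compl]
      exact hBmin Wᶜ (EdgeEnds.finite_boundary_compl hW) hBW (by simpa using hAW))
    (W₀ := Z) hAZ (fun b hb => hBZ b (hB' hb)) hle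
  obtain ⟨Q, hQ, hd⟩ := EdgeEnds.exists_edgeDisjoint_paths hAfin hBfin hZ
    (fun a ha => hAZ a (hA' ha)) (fun b hb => hBZ b (hB' hb)) hAmin
  have hQ' : ∀ i, EdgeEnds.IsPathBetween A B (Q i) := fun i => by
    obtain ⟨a, ha, b, hb, h⟩ := hQ i
    exact ⟨a, hA' ha, b, hB' hb, h⟩
  -- Two equal edge-disjoint paths would have no edges at all, and an edgeless `A`–`B` path would
  -- avoid `F`.
  have hinj : Function.Injective Q := fun i j hij => by
    by_contra hne
    have hself := hd i j hne
    rw [← hij, disjoint_self] at hself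
    exact hF.2 ⟨Q i, hQ' i, hself ▸ disjoint_bot_left⟩
  refine ⟨Set.range Q, ?_, Set.forall_mem_range.mpr hQ', ?_⟩
  · rw [← Set.image_univ, hinj.encard_image]
    simp
  · rintro _ ⟨i, rfl⟩ _ ⟨j, rfl⟩ hij
    exact hd i j fun h => hij (congrArg Q h)
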